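/- For sets $X,Y\subseteq\omega$ let $X\oplus Y=\{2n:n\in X\}\cup\{2n+1:n\in Y\}$. For $n>0$, call a set $A\subseteq\omega$ \emph{properly $\Sigma^X_n$} if it is $\Sigma^X_n$ but not $\Pi^X_n$, \emph{properly $\Pi^X_n$} if it is $\Pi^X_n$ but not $\Sigma^X_n$, and \emph{properly $\Delta^X_{n+1}$} if it is $\Delta^X_{n+1}$ but neither $\Sigma^X_n$ nor $\Pi^X_n$. A set $Y$ \emph{preserves the arithmetic hierarchy relative to $Z$} if, for every $n>0$ and every $\Xi$ among $\Sigma^0_n,\Pi^0_n,\Delta^0_{n+1}$, every set that is properly $\Xi$ relative to $Z$ is properly $\Xi$ relative to $Z\oplus Y$. A statement $(\forall X)(\exists Y)\varphi(X,Y)$ with $\varphi$ arithmetic \emph{admits preservation of the arithmetic hierarchy} if for all $Z\subseteq\omega$ and $X\leq_T Z$ there is $Y$ such that $\varphi(X,Y)$ holds and $Y$ preserves the arithmetic hierarchy relative to $Z$. The Rainbow Ramsey Theorem $\mathsf{RRT}^2_2$ is the statement that for every coloring $f:[\omega]^2\to\omega$ that is $2$-bounded (that is, $|f^{-1}(c)|\leq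 2$ for every $c\in\omega$) there is an infinite rainbow, that is, an infinite set $Y\subseteq\omega$ such that $f$ is injective on $[Y]^2$. Here the coloring $f$ is coded by its graph, a set $X\subseteq\omega$. \textbf{Theorem.} $\mathsf{RRT}^2_2$ admits preservation of the arithmetic hierarchy. Explicitly: for every $Z\subseteq\omega$ and every $2$-bounded coloring $f:[\omega]^2\to\omega$ with $f\leq_T Z$, there is an infinite set $Y\subseteq\omega$ such that $f$ is injective on $[Y]^2$ and $Y$ preserves the arithmetic hierarchy relative to $Z$. -/

import Mathlib

namespace DefStrength

/-! ### Turing reducibility of sets and the relativized arithmetic hierarchy -/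

/-- The characteristic function of a set of natural numbers, as a (total) element of `ℕ →. ℕ`. -/
noncomputable def charFun (A : Set ℕ) : ℕ →. ℕ :=
  fun n => Part.some (A.indicator (fun _ => 1) n)

/-- `X ≤_T Z` for sets of natural numbers. -/
def SetReducible (X Z : Set ℕ) : Prop :=
  TuringReducible (charFun X) (charFun Z)

/-- The effective join `X ⊕ Y = {2 n | n ∈ X} ∪ {2 n + 1 | n ∈ Y}`. -/
def join (X Y : Set ℕ) : Set ℕ :=
  {m | (∃ n ∈ X, m = 2 * n) ∨ (∃ n ∈ Y, m = 2 * n + 1)}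

/-- `IsSigma X n A`: the set `A` is `Σ^X_n`.  The `Σ^X_0` sets are the `X`-computable ones, and `A`
is `Σ^X_{n+1}` if `A = {x | ∃ y, ⟨x, y⟩ ∈ B}` for some set `B` that is `Π^X_n`, that is, whose
complement is `Σ^X_n`. -/
def IsSigma (X : Set ℕ) : ℕ → Set ℕ → Prop
  | 0, A => SetReducible A X
  | n + 1, A => ∃ B : Set ℕ, IsSigma X n Bᶜ ∧ A = {x | ∃ y, Nat.pair x y ∈ B}

/-- The set `A` is `Π^X_n`. -/
def IsPi (X : Set ℕ) (n : ℕ) (A : Set ℕ) : Prop :=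
  IsSigma X n Aᶜ

/-- The set `A` is `Δ^X_n`. -/
def IsDelta (X : Set ℕ) (n : ℕ) (A : Set ℕ) : Prop :=
  IsSigma X n A ∧ IsPi X n A

/-- `A` is properly `Σ^X_n`: it is `Σ^X_n` but not `Π^X_n`. -/
def ProperlySigma (n : ℕ) (X A : Set ℕ) : Prop :=
  IsSigma X n A ∧ ¬ IsPi X n A

/-- `A` is properly `Π^X_n`: it is `Π^X_n` but not `Σ^X_n`. -/
def ProperlyPi (n : ℕ) (X A : Set ℕ) : Prop :=
  IsPi X n A ∧ ¬ IsSigma X n A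

/-- `A` is properly `Δ^X_{n+1}`: it is `Δ^X_{n+1}`, but neither `Σ^X_n` nor `Π^X_n`. -/
def ProperlyDeltaSucc (n : ℕ) (X A : Set ℕ) : Prop :=
  IsDelta X (n + 1) A ∧ ¬ IsSigma X n A ∧ ¬ IsPi X n A

/-! ### Preservation -/

/-- `Y` preserves `Ξ`-definitions relative to `X`, where `P X A` says that `A` is properly `Ξ`
relative to `X`: every set that is properly `Ξ` relative to `X` is properly `Ξ` relative to
`X ⊕ Y`. -/
def PreservesDefinitions (P : Set ℕ → Set ℕ → Prop) (X Y : Set ℕ) : Prop :=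
  ∀ A : Set ℕ, P X A → P (join X Y) A

/-- `Y` preserves the arithmetic hierarchy relative to `X`: it preserves `Ξ`-definitions relative
to `X` for every `Ξ` among `Σ^0_n`, `Π^0_n`, `Δ^0_{n+1}` with `n > 0`. -/
def PreservesArithmeticHierarchy (X Y : Set ℕ) : Prop :=
  ∀ n : ℕ, 0 < n →
    PreservesDefinitions (ProperlySigma n) X Y ∧
    PreservesDefinitions (ProperlyPi n) X Y ∧
    PreservesDefinitions (ProperlyDeltaSucc n) X Y

/-- The sentence `(∀ X) (∃ Y) φ(X, Y)` admits preservation of the arithmetic hierarchy. -/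
def AdmitsPreservationOfArithmeticHierarchy (φ : Set ℕ → Set ℕ → Prop) : Prop :=
  ∀ Z X : Set ℕ, SetReducible X Z →
    ∃ Y : Set ℕ, PreservesArithmeticHierarchy Z Y ∧ φ X Y

/-! ### The rainbow Ramsey theorem for 2-bounded colorings of pairs -/

/-- `[X]^2`, with two-element sets written as increasing pairs. -/
def increasingPairs (X : Set ℕ) : Set (ℕ × ℕ) :=
  {p | p.1 ∈ X ∧ p.2 ∈ X ∧ p.1 < p.2}

/-- The coloring `f : [ω]^2 → ω` is `2`-bounded: each color is used at most twice.
A coloring of `[ω]^2` is represented by a function on `ℕ × ℕ` of which only the values at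
increasing pairs are ever used. -/
def TwoBounded (f : ℕ × ℕ → ℕ) : Prop :=
  ∀ c : ℕ, {p ∈ increasingPairs Set.univ | f p = c}.encard ≤ 2

/-- `Y` is a rainbow for `f`: `f` is injective on `[Y]^2`. -/
def IsRainbow (f : ℕ × ℕ → ℕ) (Y : Set ℕ) : Prop :=
  Set.InjOn f (increasingPairs Y)

/-- The set of natural numbers coding the coloring `f` of `[ω]^2`, namely its graph. It determines
`f` on increasing pairs. -/
def coloringCode (f : ℕ × ℕ → ℕ) : Set ℕ :=
  {m | ∃ p ∈ increasingPairs Set.univ, m = Nat.pair (Nat.pair p.1 p.2) (f p)}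

/-- The matrix `φ(X, Y)` of `RRT^2_2 = (∀ X) (∃ Y) φ(X, Y)`: if `X` is (the code of) a `2`-bounded
coloring of `[ω]^2`, then `Y` is an infinite rainbow for that coloring. -/
def RRT22 (X Y : Set ℕ) : Prop :=
  ∀ f : ℕ × ℕ → ℕ, X = coloringCode f → TwoBounded f → Y.Infinite ∧ IsRainbow f Y

end DefStrength

namespace DefStrength

/-! ### The use principle -/

/-! The rainbow is chosen at random. Its `k`-th element is the number with index `r k` among the
one-point end extensions of the finite rainbow built so far, where `r k` is uniform below `4 ^ (k +
1)` and the choices are independent. Two facts then suffice: almost every outcome preserves the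
hierarchy, and the construction yields an infinite set with positive probability.

Preservation is a majority vote. Suppose that a fixed predicate, definable from `Z`, the coloring
and the random sequence, defines the set `A` for a non-null set of sequences. Some event on finitely
many coordinates then has positive probability and gives this set conditional probability above 1/2
(`exists_half_lt_cond`). So `x` is in `A` exactly when the predicate holds of `x` with conditional
probability above 1/2. Strict rational lower bounds on the measure of a definable event are no more
complex than the event itself (`SigmaClass.measureAbove`, with base case `measureAbove_cond_zero`),
so `A` is already definable at the same level without the sequence
(`SigmaClass.of_measure_ne_zero`). There are only countably many predicates and countably many sets
arithmetic in `Z`, so one null set covers all failures (`ae_preservesArithmeticHierarchy`).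

Infinitude is a counting argument. By 2-boundedness, an extendible rainbow with `k` elements has at
most `k` one-point extensions that are no longer extendible (`card_le_of_not_extendible`). The
`k`-th choice is thus bad with probability at most `k / 4 ^ (k + 1)`, and these bounds sum to less
than 1 (`measure_bad_lt_one`). If no choice is bad, the construction never stops
(`infinite_rainbowSet`). -/

/-- The list `[g 0, …, g (s - 1)]`. -/
def initialSegment (g : ℕ → ℕ) (s : ℕ) : List ℕ :=
  (List.range s).map g

@[simp]
theorem length_initialSegment (g : ℕ → ℕ) (s : ℕ) : (initialSegment g s).length = s := by
  simp [initialSegment]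

theorem getElem?_initialSegment (g : ℕ → ℕ) {s i : ℕ} (h : i < s) :
    (initialSegment g s)[i]? = some (g i) := by
  simp [initialSegment, h]

theorem getD_initialSegment (g : ℕ → ℕ) {s i : ℕ} (h : i < s) :
    (initialSegment g s).getD i 0 = g i := by
  simp [initialSegment, h]

theorem take_initialSegment (g : ℕ → ℕ) {s t : ℕ} (h : t ≤ s) :
    (initialSegment g s).take t = initialSegment g t := by
  simp [initialSegment, ← List.map_take, List.take_range, h]

theorem initialSegment_succ (g : ℕ → ℕ) (s : ℕ) :
    initialSegment g (s + 1) = initialSegment g s ++ [g s] := by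
  simp [initialSegment, List.range_succ]

/-- `G` computes `f` from the initial segments of the oracle `g`: every value that it yields is
correct, and every value of `f` is yielded by all sufficiently long initial segments. -/
structure ApproximatesFrom (g : ℕ → ℕ) (G : List ℕ × ℕ →. ℕ) (f : ℕ →. ℕ) : Prop where
  sound : ∀ t n m, m ∈ G (initialSegment g t, n) → m ∈ f n
  complete : ∀ n m, m ∈ f n → ∃ s, ∀ t ≥ s, m ∈ G (initialSegment g t, n)

theorem ApproximatesFrom.of_partrec (g : ℕ → ℕ) (f : ℕ →. ℕ) :
    ApproximatesFrom g (fun p => f p.2) f :=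
  ⟨fun _ _ _ h => h, fun _ _ h => ⟨0, fun _ _ => h⟩⟩

theorem ApproximatesFrom.oracle (g : ℕ → ℕ) :
    ApproximatesFrom g (fun p => (p.1[p.2]? : Part ℕ)) (fun n => Part.some (g n)) := by
  constructor
  · intro t n m h
    simp only [Part.mem_ofOption, initialSegment, Option.mem_def] at h
    simp only [List.getElem?_map, Option.map_eq_some_iff] at h
    obtain ⟨a, ha, rfl⟩ := h
    obtain ⟨_, rfl⟩ := List.getElem?_eq_some_iff.1 ha
    simp
  · intro n m h
    refine ⟨n + 1, fun t ht => ?_⟩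
    simp only [Part.mem_some_iff] at h
    simp [getElem?_initialSegment g (show n < t by omega), h]

theorem ApproximatesFrom.pair {g : ℕ → ℕ} {G H : List ℕ × ℕ →. ℕ} {f h : ℕ →. ℕ}
    (hf : ApproximatesFrom g G f) (hh : ApproximatesFrom g H h) :
    ApproximatesFrom g (fun p => (G p).bind fun a => (H p).map fun b => Nat.pair a b)
      (fun n => Nat.pair <$> f n <*> h n) := by
  constructor
  · intro t n m hm
    simp only [Part.mem_bind_iff, Part.mem_map_iff] at hm
    obtain ⟨a, ha, b, hb, rfl⟩ := hm
    simp only [Seq.seq, Part.map_eq_map, Part.mem_bind_iff, Part.mem_map_iff]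
    exact ⟨_, ⟨a, hf.sound _ _ _ ha, rfl⟩, b, hh.sound _ _ _ hb, rfl⟩
  · intro n m hm
    simp only [Seq.seq, Part.map_eq_map, Part.mem_bind_iff, Part.mem_map_iff] at hm
    obtain ⟨_, ⟨a, ha, rfl⟩, b, hb, rfl⟩ := hm
    obtain ⟨s, hs⟩ := hf.complete _ _ ha
    obtain ⟨s', hs'⟩ := hh.complete _ _ hb
    refine ⟨max s s', fun t ht => ?_⟩
    simp only [Part.mem_bind_iff, Part.mem_map_iff]
    exact ⟨a, hs t (le_trans (le_max_left _ _) ht), b, hs' t (le_trans (le_max_right _ _) ht), rfl⟩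

theorem ApproximatesFrom.comp {g : ℕ → ℕ} {G H : List ℕ × ℕ →. ℕ} {f h : ℕ →. ℕ}
    (hf : ApproximatesFrom g G f) (hh : ApproximatesFrom g H h) :
    ApproximatesFrom g (fun p => (H p).bind fun a => G (p.1, a)) (fun n => h n >>= f) := by
  constructor
  · intro t n m hm
    simp only [Part.mem_bind_iff] at hm
    obtain ⟨a, ha, hb⟩ := hm
    exact Part.mem_bind (hh.sound _ _ _ ha) (hf.sound _ _ _ hb)
  · intro n m hm
    obtain ⟨a, ha, hb⟩ := Part.mem_bind_iff.1 hm
    obtain ⟨s, hs⟩ := hh.complete _ _ ha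
    obtain ⟨s', hs'⟩ := hf.complete _ _ hb
    exact ⟨max s s', fun t ht => Part.mem_bind (hs t (le_trans (le_max_left _ _) ht))
      (hs' t (le_trans (le_max_right _ _) ht))⟩

theorem ApproximatesFrom.prec {g : ℕ → ℕ} {G H : List ℕ × ℕ →. ℕ} {f h : ℕ →. ℕ}
    (hf : ApproximatesFrom g G f) (hh : ApproximatesFrom g H h) :
    ApproximatesFrom g
      (fun p => p.2.unpair.2.rec (G (p.1, p.2.unpair.1)) fun y IH =>
        IH.bind fun i => H (p.1, Nat.pair p.2.unpair.1 (Nat.pair y i)))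
      (fun p =>
        let (a, n) := Nat.unpair p
        n.rec (f a) fun y IH => do
          let i ← IH
          h (Nat.pair a (Nat.pair y i))) := by
  constructor
  · intro t p m hm
    generalize hq : p.unpair = q at hm
    obtain ⟨a, n⟩ := q
    simp only at hm ⊢
    induction n generalizing m p with
    | zero => exact hf.sound _ _ _ hm
    | succ n ih =>
      obtain ⟨i, hi, hm⟩ := Part.mem_bind_iff.1 hm
      exact Part.mem_bind (ih (Nat.pair a n) i (by simp) hi) (hh.sound _ _ _ hm)
  · intro p m hm
    generalize hq : p.unpair = q at hm
    obtain ⟨a, n⟩ := q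
    simp only [hq] at hm ⊢
    induction n generalizing m p with
    | zero => exact hf.complete _ _ hm
    | succ n ih =>
      obtain ⟨i, hi, hm⟩ := Part.mem_bind_iff.1 hm
      obtain ⟨s, hs⟩ := ih (Nat.pair a n) i (by simp) hi
      obtain ⟨s', hs'⟩ := hh.complete _ _ hm
      exact ⟨max s s', fun t ht => Part.mem_bind (hs t (le_trans (le_max_left _ _) ht))
        (hs' t (le_trans (le_max_right _ _) ht))⟩

theorem ApproximatesFrom.rfind {g : ℕ → ℕ} {G : List ℕ × ℕ →. ℕ} {f : ℕ →. ℕ}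
    (hf : ApproximatesFrom g G f) :
    ApproximatesFrom g
      (fun p => Nat.rfind fun n => (G (p.1, Nat.pair p.2 n)).map fun m => decide (m = 0))
      (fun a => Nat.rfind fun n => (fun m => decide (m = 0)) <$> f (Nat.pair a n)) := by
  constructor
  · intro t n m hm
    obtain ⟨h1, h2⟩ := Nat.mem_rfind.1 hm
    refine Nat.mem_rfind.2 ⟨?_, fun {k} hk => ?_⟩
    · obtain ⟨a, ha, h0⟩ := (Part.mem_map_iff _).1 h1
      exact (Part.mem_map_iff _).2 ⟨a, hf.sound _ _ _ ha, h0⟩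
    · obtain ⟨a, ha, h0⟩ := (Part.mem_map_iff _).1 (h2 hk)
      exact (Part.mem_map_iff _).2 ⟨a, hf.sound _ _ _ ha, h0⟩
  · intro n m hm
    obtain ⟨h1, hlt⟩ := Nat.mem_rfind.1 hm
    obtain ⟨a, ha, h0⟩ := (Part.mem_map_iff _).1 h1
    obtain ⟨s, hs⟩ := hf.complete _ _ ha
    -- The dummy stage 0 for `k ≥ m` makes `u` total, so that `choose` applies and a supremum over
    -- `k < m` bounds all the stages needed.
    have hlt' : ∀ k, ∃ u, k < m → ∀ t ≥ u,
        ∃ a ∈ G (initialSegment g t, Nat.pair n k), decide (a = 0) = false := by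
      intro k
      by_cases hk : k < m
      · obtain ⟨b, hb, hb0⟩ := (Part.mem_map_iff _).1 (hlt hk)
        obtain ⟨u, hu⟩ := hf.complete _ _ hb
        exact ⟨u, fun _ t ht => ⟨b, hu t ht, hb0⟩⟩
      · exact ⟨0, fun h => absurd h hk⟩
    choose u hu using hlt'
    refine ⟨max s ((Finset.range m).sup u), fun t ht => Nat.mem_rfind.2 ⟨(Part.mem_map_iff _).2
      ⟨a, hs t (le_trans (le_max_left _ _) ht), h0⟩,
      fun {k} hk => (Part.mem_map_iff _).2 (hu k hk t ?_)⟩⟩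
    exact le_trans (le_trans (Finset.le_sup (f := u) (Finset.mem_range.2 hk)) (le_max_right _ _)) ht

/-- The use principle: a function that is recursive in a total oracle is computed from the finite
initial segments of the oracle by a partial recursive function. -/
theorem exists_partrec_approximatesFrom {g : ℕ → ℕ} {f : ℕ →. ℕ}
    (hf : Nat.RecursiveIn {fun n => Part.some (g n)} f) :
    ∃ G : List ℕ × ℕ →. ℕ, Partrec G ∧ ApproximatesFrom g G f := by
  induction hf with
  | zero => exact ⟨_, (Partrec.nat_iff.2 Nat.Partrec.zero).comp Computable.snd, .of_partrec _ _⟩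
  | succ => exact ⟨_, (Partrec.nat_iff.2 Nat.Partrec.succ).comp Computable.snd, .of_partrec _ _⟩
  | left => exact ⟨_, (Partrec.nat_iff.2 Nat.Partrec.left).comp Computable.snd, .of_partrec _ _⟩
  | right => exact ⟨_, (Partrec.nat_iff.2 Nat.Partrec.right).comp Computable.snd, .of_partrec _ _⟩
  | oracle h hh =>
    obtain rfl := hh
    exact ⟨_, Computable.ofOption Primrec.list_getElem?.to_comp, .oracle g⟩
  | pair _ _ ih₁ ih₂ =>
    obtain ⟨G, hG, hf⟩ := ih₁
    obtain ⟨H, hH, hh⟩ := ih₂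
    refine ⟨_, ?_, hf.pair hh⟩
    refine hG.bind ((hH.comp Computable.fst).map ?_)
    exact (Primrec₂.natPair.comp (Primrec.snd.comp Primrec.fst) Primrec.snd).to_comp
  | comp _ _ ih₁ ih₂ =>
    obtain ⟨G, hG, hf⟩ := ih₁
    obtain ⟨H, hH, hh⟩ := ih₂
    refine ⟨_, ?_, hf.comp hh⟩
    refine hH.bind (hG.comp ?_)
    exact ((Primrec.fst.comp Primrec.fst).pair Primrec.snd).to_comp
  | prec _ _ ih₁ ih₂ =>
    obtain ⟨G, hG, hf⟩ := ih₁
    obtain ⟨H, hH, hh⟩ := ih₂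
    refine ⟨_, ?_, hf.prec hh⟩
    have hu : Primrec fun p : List ℕ × ℕ => p.2.unpair := Primrec.unpair.comp Primrec.snd
    refine Partrec.nat_rec (f := fun p : List ℕ × ℕ => p.2.unpair.2)
      (g := fun p : List ℕ × ℕ => G (p.1, p.2.unpair.1))
      (h := fun p q => H (p.1, Nat.pair p.2.unpair.1 (Nat.pair q.1 q.2)))
      (Primrec.snd.comp hu).to_comp (hG.comp ?_) (hH.comp ?_)
    · exact (Primrec.fst.pair (Primrec.fst.comp hu)).to_comp
    · exact ((Primrec.fst.comp Primrec.fst).pair (Primrec₂.natPair.comp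
        (Primrec.fst.comp (hu.comp Primrec.fst)) (Primrec₂.natPair.comp
          (Primrec.fst.comp Primrec.snd) (Primrec.snd.comp Primrec.snd)))).to_comp
  | rfind _ ih =>
    obtain ⟨G, hG, hf⟩ := ih
    refine ⟨_, ?_, hf.rfind⟩
    refine Partrec.rfind ((hG.comp ?_).map ?_)
    · exact ((Primrec.fst.comp Primrec.fst).pair (Primrec₂.natPair.comp
        (Primrec.snd.comp Primrec.fst) Primrec.snd)).to_comp
    · exact (Primrec.eq.comp Primrec.snd (Primrec.const 0)).decide.to_comp

/-- The characteristic function of a set, with values in `ℕ`. -/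
noncomputable def natIndicator (A : Set ℕ) : ℕ → ℕ :=
  A.indicator fun _ => 1

/-- Every `Σ^X_1` set is defined by a primitive recursive condition on the initial segments
of `X`. -/
theorem exists_primrecRel_of_isSigma_one {X A : Set ℕ} (h : IsSigma X 1 A) :
    ∃ R : ℕ → List ℕ → Prop, PrimrecRel R ∧
      ∀ x, x ∈ A ↔ ∃ s, R x (initialSegment (natIndicator X) s) := by
  obtain ⟨B, hB, rfl⟩ := h
  obtain ⟨G, hG, hf⟩ := exists_partrec_approximatesFrom (g := natIndicator X)
    (RecursiveIn.iff_nat.1 hB)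
  obtain ⟨c, hc⟩ := Nat.Partrec.Code.exists_code.1 hG
  have hmem : ∀ z, z ∈ B ↔ 0 ∈ charFun Bᶜ z := by
    intro z
    by_cases hz : z ∈ B <;> simp [charFun, hz]
  have hcode : ∀ L z, 0 ∈ G (L, z) ↔ ∃ k, c.evaln k (Encodable.encode (L, z)) = some 0 := by
    intro L z
    have h1 : c.eval (Encodable.encode (L, z)) = G (L, z) := by
      rw [hc]
      simp [Part.map_id']
    rw [← h1, Nat.Partrec.Code.evaln_complete]
    rfl
  -- The length of the segment codes three numbers: the witness `y`, the use `s` and the bound `k`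
  -- on the computation. Every segment has a length of its own, so all triples are tried.
  refine ⟨fun x L => c.evaln L.length.unpair.2.unpair.2
    (Encodable.encode (L.take L.length.unpair.2.unpair.1, Nat.pair x L.length.unpair.1)) = some 0,
    ?_, fun x => ?_⟩
  · have hu : Primrec fun p : ℕ × List ℕ => p.2.length.unpair :=
      Primrec.unpair.comp (Primrec.list_length.comp Primrec.snd)
    have hv : Primrec fun p : ℕ × List ℕ => p.2.length.unpair.2.unpair :=
      Primrec.unpair.comp (Primrec.snd.comp hu)
    refine Primrec.eq.comp (Nat.Partrec.Code.primrec_evaln.comp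
      (((Primrec.snd.comp hv).pair (Primrec.const c)).pair (Primrec.encode.comp (Primrec.pair
        (Primrec.list_take.comp (Primrec.fst.comp hv) Primrec.snd)
        (Primrec₂.natPair.comp Primrec.fst (Primrec.fst.comp hu)))))) (Primrec.const _)
  · constructor
    · rintro ⟨y, hy⟩
      rw [hmem] at hy
      obtain ⟨s, hs⟩ := hf.complete _ _ hy
      obtain ⟨k, hk⟩ := (hcode _ _).1 (hs s le_rfl)
      refine ⟨Nat.pair y (Nat.pair s k), ?_⟩
      simp only [length_initialSegment, Nat.unpair_pair]
      rwa [take_initialSegment]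
      exact (Nat.left_le_pair _ _).trans (Nat.right_le_pair _ _)
    · rintro ⟨s, hs⟩
      simp only [length_initialSegment] at hs
      rw [take_initialSegment _ ((Nat.unpair_left_le _).trans (Nat.unpair_right_le _))] at hs
      exact ⟨s.unpair.1, (hmem _).2 (hf.sound _ _ _ ((hcode _ _).2 ⟨_, hs⟩))⟩

end DefStrength

namespace DefStrength

/-! ### The arithmetic hierarchy relative to a varying oracle -/

/-- The lightface class `Σ^O_{n+1}` of predicates `P x ω`, uniformly in the point `ω` of `Ω`,
relative to an oracle `O ω` that depends on the point. -/
def SigmaClass {Ω : Type*} (O : Ω → ℕ → ℕ) : ℕ → (ℕ → Ω → Prop) → Prop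
  | 0, P => ∃ R : ℕ → List ℕ → Prop, PrimrecRel R ∧
      ∀ x ω, P x ω ↔ ∃ s, R x (initialSegment (O ω) s)
  | n + 1, P => ∃ Q : ℕ → Ω → Prop, SigmaClass O n Q ∧ ∀ x ω, P x ω ↔ ∃ y, ¬ Q (Nat.pair x y) ω

theorem PrimrecRel.forall_lt_param {α : Type*} [Primcodable α] {S : ℕ → α → Prop}
    (hS : PrimrecRel S) : PrimrecRel fun n a => ∀ i < n, S i a :=
  (hS.forall_mem_list.comp (Primrec.list_range.comp Primrec.fst) Primrec.snd).of_eq (by simp)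

theorem PrimrecRel.exists_lt_param {α : Type*} [Primcodable α] {S : ℕ → α → Prop}
    (hS : PrimrecRel S) : PrimrecRel fun n a => ∃ i < n, S i a :=
  (hS.exists_mem_list.comp (Primrec.list_range.comp Primrec.fst) Primrec.snd).of_eq (by simp)

namespace SigmaClass

variable {Ω : Type*} {O : Ω → ℕ → ℕ} {n : ℕ} {P : ℕ → Ω → Prop}

/-! ### Closure of the classes under substitution and quantifiers -/

theorem congr {P' : ℕ → Ω → Prop} (hP : SigmaClass O n P) (h : ∀ x ω, P' x ω ↔ P x ω) :
    SigmaClass O n P' := by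
  obtain rfl : P' = P := funext fun x => funext fun ω => propext (h x ω)
  exact hP

theorem comp (hP : SigmaClass O n P) {h : ℕ → ℕ} (hh : Primrec h) :
    SigmaClass O n fun x ω => P (h x) ω := by
  induction n generalizing P h with
  | zero =>
    obtain ⟨R, hR, hRP⟩ := hP
    exact ⟨fun x L => R (h x) L, hR.comp (hh.comp Primrec.fst) Primrec.snd, fun x ω => hRP _ _⟩
  | succ n ih =>
    obtain ⟨Q, hQ, hQP⟩ := hP
    refine ⟨fun z => Q (Nat.pair (h z.unpair.1) z.unpair.2), ih hQ (h := fun z =>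
      Nat.pair (h z.unpair.1) z.unpair.2) ?_, fun x ω => ?_⟩
    · exact Primrec₂.natPair.comp (hh.comp (Primrec.fst.comp Primrec.unpair))
        (Primrec.snd.comp Primrec.unpair)
    · simp [hQP]

/-- At the lowest level the length of the segment codes both the witness and the use. At higher
levels two adjacent existential quantifiers are contracted by pairing. -/
theorem exists_nat (hP : SigmaClass O n P) :
    SigmaClass O n fun x ω => ∃ y, P (Nat.pair x y) ω := by
  cases n with
  | zero =>
    obtain ⟨R, hR, hRP⟩ := hP
    refine ⟨fun x L => R (Nat.pair x L.length.unpair.1) (L.take L.length.unpair.2), ?_,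
      fun x ω => ?_⟩
    · have hu : Primrec fun p : ℕ × List ℕ => p.2.length.unpair :=
        Primrec.unpair.comp (Primrec.list_length.comp Primrec.snd)
      exact hR.comp (Primrec₂.natPair.comp Primrec.fst (Primrec.fst.comp hu))
        (Primrec.list_take.comp (Primrec.snd.comp hu) Primrec.snd)
    · simp only [hRP, length_initialSegment]
      constructor
      · rintro ⟨y, s, h⟩
        refine ⟨Nat.pair y s, ?_⟩
        rw [take_initialSegment _ (Nat.unpair_right_le _)]
        simpa using h
      · rintro ⟨s, h⟩
        rw [take_initialSegment _ (Nat.unpair_right_le _)] at h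
        exact ⟨_, _, h⟩
  | succ n =>
    obtain ⟨Q, hQ, hQP⟩ := hP
    refine ⟨_, hQ.comp (h := fun z => Nat.pair (Nat.pair z.unpair.1 z.unpair.2.unpair.1)
      z.unpair.2.unpair.2) ?_, fun x ω => ?_⟩
    · have h1 : Primrec fun z : ℕ => z.unpair.1 := Primrec.fst.comp Primrec.unpair
      have h2 : Primrec fun z : ℕ => z.unpair.2 := Primrec.snd.comp Primrec.unpair
      exact Primrec₂.natPair.comp (Primrec₂.natPair.comp h1 (h1.comp h2)) (h2.comp h2)
    · simp only [hQP, Nat.unpair_pair]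
      constructor
      · rintro ⟨y, z, h⟩
        exact ⟨Nat.pair y z, by simpa using h⟩
      · rintro ⟨y, h⟩
        exact ⟨_, _, h⟩

theorem exists_le (hP : SigmaClass O n P) :
    SigmaClass O n fun x ω => ∃ y ≤ x.unpair.2, P (Nat.pair x.unpair.1 y) ω := by
  refine (exists_nat (hP.comp (h := fun z => Nat.pair z.unpair.1.unpair.1
    (min z.unpair.2 z.unpair.1.unpair.2)) ?_)).congr fun x ω => ?_
  · have h1 : Primrec fun z : ℕ => z.unpair.1 := Primrec.fst.comp Primrec.unpair
    have h2 : Primrec fun z : ℕ => z.unpair.2 := Primrec.snd.comp Primrec.unpair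
    exact Primrec₂.natPair.comp (h1.comp h1) (Primrec.nat_min.comp h2 (h2.comp h1))
  · simp only [Nat.unpair_pair]
    constructor
    · rintro ⟨y, hy, h⟩
      exact ⟨y, by rwa [min_eq_left hy]⟩
    · rintro ⟨y, h⟩
      exact ⟨_, min_le_right _ _, h⟩

/-- Collection. At the lowest level finitely many searches succeed by a common stage. At higher
levels the witnesses are stored in one coded list; the bounded quantifier then passes under the
negation, where `exists_le` absorbs it. -/
theorem forall_le (hP : SigmaClass O n P) :
    SigmaClass O n fun x ω => ∀ y ≤ x.unpair.2, P (Nat.pair x.unpair.1 y) ω := by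
  have h1 : Primrec fun z : ℕ => z.unpair.1 := Primrec.fst.comp Primrec.unpair
  have h2 : Primrec fun z : ℕ => z.unpair.2 := Primrec.snd.comp Primrec.unpair
  cases n with
  | zero =>
    obtain ⟨R, hR, hRP⟩ := hP
    have hS : PrimrecRel fun (t : ℕ) (a : ℕ × ℕ × List ℕ) =>
        R (Nat.pair a.2.1.unpair.1 a.1) (a.2.2.take t) := by
      refine hR.comp (Primrec₂.natPair.comp ?_ ?_) (Primrec.list_take.comp Primrec.fst ?_)
      · exact h1.comp (Primrec.fst.comp (Primrec.snd.comp Primrec.snd))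
      · exact Primrec.fst.comp Primrec.snd
      · exact Primrec.snd.comp (Primrec.snd.comp Primrec.snd)
    have hS' : PrimrecRel fun (y : ℕ) (a : ℕ × List ℕ) => ∃ t < a.2.length + 1,
        R (Nat.pair a.1.unpair.1 y) (a.2.take t) :=
      (PrimrecRel.exists_lt_param hS).comp
        (Primrec.succ.comp (Primrec.list_length.comp (Primrec.snd.comp Primrec.snd))) Primrec.id
    refine ⟨fun x L => ∀ y < x.unpair.2 + 1, ∃ t < L.length + 1,
      R (Nat.pair x.unpair.1 y) (L.take t), (PrimrecRel.forall_lt_param hS').comp (f := fun p : ℕ × List ℕ =>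
      p.1.unpair.2 + 1) (Primrec.succ.comp (h2.comp Primrec.fst)) Primrec.id, fun x ω => ?_⟩
    simp only [hRP, length_initialSegment, Nat.lt_succ_iff]
    constructor
    · intro h
      choose! u hu using h
      refine ⟨(Finset.range (x.unpair.2 + 1)).sup u, fun y hy => ⟨u y, ?_, ?_⟩⟩
      · exact Finset.le_sup (f := u) (Finset.mem_range.2 (Nat.lt_succ_iff.2 hy))
      · rw [take_initialSegment]
        · exact hu y hy
        · exact Finset.le_sup (f := u) (Finset.mem_range.2 (Nat.lt_succ_iff.2 hy))
    · rintro ⟨s, h⟩ y hy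
      obtain ⟨t, ht, h⟩ := h y hy
      rw [take_initialSegment _ ht] at h
      exact ⟨t, h⟩
  | succ n =>
    obtain ⟨Q, hQ, hQP⟩ := hP
    have hQ' : SigmaClass O n fun v ω => Q (Nat.pair (Nat.pair v.unpair.1.unpair.1 v.unpair.2)
        ((Denumerable.ofNat (List ℕ) v.unpair.1.unpair.2).getD v.unpair.2 0)) ω := by
      refine hQ.comp (h := fun v => Nat.pair (Nat.pair v.unpair.1.unpair.1 v.unpair.2)
        ((Denumerable.ofNat (List ℕ) v.unpair.1.unpair.2).getD v.unpair.2 0)) ?_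
      exact Primrec₂.natPair.comp (Primrec₂.natPair.comp (h1.comp h1) h2)
        ((Primrec.list_getD 0).comp ((Primrec.ofNat (List ℕ)).comp (h2.comp h1)) h2)
    refine ⟨_, hQ'.exists_le.comp (h := fun z => Nat.pair (Nat.pair z.unpair.1.unpair.1 z.unpair.2)
      z.unpair.1.unpair.2) ?_, fun x ω => ?_⟩
    · exact Primrec₂.natPair.comp (Primrec₂.natPair.comp (h1.comp h1) h2) (h2.comp h1)
    · simp only [hQP, Nat.unpair_pair]
      constructor
      · intro h
        choose! z hz using h
        refine ⟨Encodable.encode (initialSegment z (x.unpair.2 + 1)), ?_⟩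
        rintro ⟨y, hy, h⟩
        rw [Denumerable.ofNat_encode, getD_initialSegment _ (Nat.lt_succ_iff.2 hy)] at h
        exact hz y hy h
      -- Conversely any code serves: an entry beyond the end of the list reads as 0, which is still
      -- a legitimate witness.
      · rintro ⟨w, h⟩ y hy
        exact ⟨_, fun h' => h ⟨y, hy, h'⟩⟩

/-! ### Countability and measurability -/

theorem countable_primrec : {f : ℕ → ℕ | Primrec f}.Countable := by
  have : ∀ f : {f : ℕ → ℕ | Primrec f}, ∃ c : Nat.Partrec.Code, c.eval = fun n => Part.some (f.1 n) :=
    fun f => Nat.Partrec.Code.exists_code.1 (Partrec.nat_iff.1 f.2.to_comp)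
  choose c hc using this
  refine Set.countable_coe_iff.1 (Function.Injective.countable (f := c) fun f g hfg => ?_)
  ext n
  have h : (Part.some (f.1 n) : Part ℕ) = Part.some (g.1 n) :=
    (congrFun (hc f) n).symm.trans ((congrArg (fun d => Nat.Partrec.Code.eval d n) hfg).trans
      (congrFun (hc g) n))
  exact Part.some_injective h

theorem countable_primrecRel : {R : ℕ → List ℕ → Prop | PrimrecRel R}.Countable := by
  refine (countable_primrec.image fun f x L => f (Encodable.encode (x, L)) = 1).mono ?_
  intro R hR
  classical
  refine ⟨fun z => if R (Denumerable.ofNat (ℕ × List ℕ) z).1 (Denumerable.ofNat (ℕ × List ℕ) z).2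
    then 1 else 0, ?_, ?_⟩
  · refine Primrec.ite ?_ (Primrec.const 1) (Primrec.const 0)
    exact PrimrecRel.comp hR (Primrec.fst.comp (Primrec.ofNat _))
      (Primrec.snd.comp (Primrec.ofNat _))
  · funext x L
    simp

theorem countable (O : Ω → ℕ → ℕ) (n : ℕ) : {P | SigmaClass O n P}.Countable := by
  induction n with
  | zero =>
    refine (countable_primrecRel.image fun R x ω => ∃ s, R x (initialSegment (O ω) s)).mono ?_
    rintro P ⟨R, hR, h⟩
    exact ⟨R, hR, by funext x ω; simp [h]⟩
  | succ n ih =>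
    refine (ih.image fun Q x ω => ∃ y, ¬ Q (Nat.pair x y) ω).mono ?_
    rintro P ⟨R, hR, h⟩
    exact ⟨R, hR, by funext x ω; simp [h]⟩

theorem measurableSet [MeasurableSpace Ω] (hO : ∀ i, Measurable fun ω => O ω i)
    (hP : SigmaClass O n P) (x : ℕ) : MeasurableSet {ω | P x ω} := by
  induction n generalizing P x with
  | zero =>
    obtain ⟨R, hR, h⟩ := hP
    let _ : MeasurableSpace (List ℕ) := ⊤
    have hseg : ∀ s, Measurable fun ω => initialSegment (O ω) s := by
      intro s
      have : (fun ω => initialSegment (O ω) s) =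
          (fun v : Fin s → ℕ => List.ofFn v) ∘ fun ω (i : Fin s) => O ω i := by
        funext ω
        apply List.ext_getElem <;> simp [initialSegment]
      rw [this]
      exact (Measurable.of_discrete (f := fun v : Fin s → ℕ => List.ofFn v)).comp
        (measurable_pi_lambda (fun ω (i : Fin s) => O ω i) fun i => hO i)
    simp only [h, Set.ofPred_exists]
    exact MeasurableSet.iUnion fun s => hseg s (show MeasurableSet {L | R x L} from trivial)
  | succ n ih =>
    obtain ⟨Q, hQ, h⟩ := hP
    simp only [h, Set.ofPred_exists]
    exact MeasurableSet.iUnion fun y => (ih hQ _).compl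

/-! ### Passage between the classes and relative `Σ` sets -/

/-- A set that is `Σ_{n+1}` relative to `X ω` is a section of a predicate in the class, if `X ω` is
uniformly computable from the oracle at `ω`. -/
theorem of_isSigma {X : Ω → Set ℕ} {φ : List ℕ → List ℕ} (hφ : Primrec φ)
    (h₁ : ∀ ω s, ∃ t, φ (initialSegment (O ω) t) = initialSegment (natIndicator (X ω)) s)
    (h₂ : ∀ ω t, ∃ s, φ (initialSegment (O ω) t) = initialSegment (natIndicator (X ω)) s)
    {ω : Ω} {A : Set ℕ} (hA : IsSigma (X ω) (n + 1) A) :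
    ∃ P, SigmaClass O n P ∧ ∀ x, x ∈ A ↔ P x ω := by
  induction n generalizing A with
  | zero =>
    obtain ⟨R, hR, h⟩ := exists_primrecRel_of_isSigma_one hA
    refine ⟨fun x ω => ∃ s, R x (φ (initialSegment (O ω) s)), ⟨fun x L => R x (φ L),
      hR.comp Primrec.fst (hφ.comp Primrec.snd), fun _ _ => Iff.rfl⟩, fun x => ?_⟩
    rw [h]
    constructor
    · rintro ⟨s, hs⟩
      obtain ⟨t, ht⟩ := h₁ ω s
      exact ⟨t, by rwa [ht]⟩
    · rintro ⟨t, ht⟩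
      obtain ⟨s, hs⟩ := h₂ ω t
      exact ⟨s, by rwa [← hs]⟩
  | succ n ih =>
    obtain ⟨B, hB, rfl⟩ := hA
    obtain ⟨Q, hQ, h⟩ := ih hB
    exact ⟨fun x ω => ∃ y, ¬ Q (Nat.pair x y) ω, ⟨Q, hQ, fun _ _ => Iff.rfl⟩, fun x => by
      simp [← h]⟩

/-- Membership in the class relative to a function recursive in `Z` yields `Σ^Z_{n+1}` sets. -/
theorem isSigma {F : ℕ → ℕ} {Z : Set ℕ} (hF : Nat.RecursiveIn {charFun Z} fun n => Part.some (F n))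
    {P : ℕ → Unit → Prop} (hP : SigmaClass (fun _ => F) n P) :
    IsSigma Z (n + 1) {x | P x ()} := by
  induction n generalizing P with
  | zero =>
    obtain ⟨R, hR, h⟩ := hP
    classical
    refine ⟨{z | R z.unpair.1 (initialSegment F z.unpair.2)}, ?_, by ext x; simp [h]⟩
    have happ : Nat.Primrec fun v => Encodable.encode
        (Denumerable.ofNat (List ℕ) v.unpair.1 ++ [v.unpair.2]) :=
      Primrec.nat_iff.1 (Primrec.encode.comp (Primrec.list_concat.comp
        ((Primrec.ofNat (List ℕ)).comp (Primrec.fst.comp Primrec.unpair))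
        (Primrec.snd.comp Primrec.unpair)))
    -- The value is 0 on true instances because the reducibility demanded by `IsSigma` concerns the
    -- complement of the matrix.
    have hdec : Nat.Primrec fun v => if R v.unpair.1 (Denumerable.ofNat (List ℕ) v.unpair.2)
        then 0 else 1 :=
      Primrec.nat_iff.1 (Primrec.ite (hR.comp (Primrec.fst.comp Primrec.unpair)
        ((Primrec.ofNat (List ℕ)).comp (Primrec.snd.comp Primrec.unpair)))
        (Primrec.const 0) (Primrec.const 1))
    have hz : Nat.Primrec fun _ => Encodable.encode ([] : List ℕ) := Nat.Primrec.const _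
    have hl : Nat.RecursiveIn {charFun Z} fun v => Part.some v.unpair.2.unpair.1 :=
      (Nat.Primrec.left.comp Nat.Primrec.right).recursiveIn
    have hr : Nat.RecursiveIn {charFun Z} fun v => Part.some v.unpair.2.unpair.2 :=
      (Nat.Primrec.right.comp Nat.Primrec.right).recursiveIn
    have hseg : Nat.RecursiveIn {charFun Z}
        fun v => Part.some (Encodable.encode (initialSegment F v.unpair.2)) := by
      refine (Nat.RecursiveIn.prec hz.recursiveIn (happ.recursiveIn.comp
        (hr.pair (hF.comp hl)))).of_eq fun v => ?_
      simp only
      generalize v.unpair.2 = s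
      induction s with
      | zero => rfl
      | succ s ih =>
        simp only [ih, initialSegment_succ]
        simp [Seq.seq]
    have hfst : Nat.RecursiveIn {charFun Z} fun v => Part.some v.unpair.1 := .left
    refine RecursiveIn.iff_nat.2 ((hdec.recursiveIn.comp (hfst.pair hseg)).of_eq fun v => ?_)
    by_cases hv : R v.unpair.1 (initialSegment F v.unpair.2) <;> simp [charFun, hv, Seq.seq]
  | succ n ih =>
    obtain ⟨Q, hQ, h⟩ := hP
    exact ⟨{z | ¬ Q z ()}, by simpa [Set.compl_ofPred] using ih hQ, by ext x; simp [h]⟩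

end SigmaClass

end DefStrength

namespace DefStrength

open MeasureTheory

/-! ### The uniform measure on sequences -/

theorem getElem_initialSegment (g : ℕ → ℕ) {s i : ℕ} (h : i < (initialSegment g s).length) :
    (initialSegment g s)[i] = g i := by
  simp [initialSegment]

/-- The sequences `ω` with `ω i < N i` for all `i`. -/
abbrev BoundedSeq (N : ℕ → ℕ) : Type :=
  ∀ i, Fin (N i)

/-- The first `s` values of a bounded sequence. -/
def BoundedSeq.take {N : ℕ → ℕ} (ω : BoundedSeq N) (s : ℕ) : List ℕ :=
  initialSegment (fun i => (ω i : ℕ)) s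

/-- The list of all initial segments of length `s` of bounded sequences. -/
def boundedLists (N : ℕ → ℕ) : ℕ → List (List ℕ)
  | 0 => [[]]
  | s + 1 => (boundedLists N s).flatMap fun τ => (List.range (N s)).map fun a => τ ++ [a]

theorem mem_boundedLists {N : ℕ → ℕ} {s : ℕ} {τ : List ℕ} :
    τ ∈ boundedLists N s ↔ τ.length = s ∧ ∀ i < s, τ.getD i 0 < N i := by
  induction s generalizing τ with
  | zero => simp [boundedLists]
  | succ s ih =>
    simp only [boundedLists, List.mem_flatMap, List.mem_map, List.mem_range, ih]
    constructor
    · rintro ⟨σ, ⟨rfl, h⟩, a, ha, rfl⟩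
      refine ⟨by simp, fun i hi => ?_⟩
      rcases Nat.lt_succ_iff_lt_or_eq.1 hi with hi | rfl
      · rw [List.getD_append _ _ _ _ hi]
        exact h i hi
      · simpa using ha
    · rintro ⟨hl, h⟩
      obtain ⟨σ, a, rfl⟩ : ∃ σ a, τ = σ ++ [a] := by
        rcases List.eq_nil_or_concat τ with rfl | ⟨σ, a, rfl⟩
        · simp at hl
        · exact ⟨σ, a, by simp⟩
      obtain rfl : σ.length = s := by simpa using hl
      refine ⟨σ, ⟨rfl, fun i hi => ?_⟩, a, ?_, rfl⟩
      · have := h i (Nat.lt_succ_of_lt hi)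
        rwa [List.getD_append _ _ _ _ hi] at this
      · simpa using h σ.length (Nat.lt_succ_self _)

theorem nodup_boundedLists (N : ℕ → ℕ) (s : ℕ) : (boundedLists N s).Nodup := by
  induction s with
  | zero => simp [boundedLists]
  | succ s ih =>
    refine List.nodup_flatMap.2 ⟨fun τ _ => List.nodup_range.map fun a b h => by simpa using h, ?_⟩
    refine ih.imp fun {σ τ} h => ?_
    simp only [Function.onFun, List.disjoint_left, List.mem_map, not_exists, not_and]
    rintro _ ⟨a, _, rfl⟩ b _ hb
    exact h (List.append_inj_left' hb rfl).symm

theorem primrec_boundedLists {N : ℕ → ℕ} (hN : Primrec N) : Primrec (boundedLists N) := by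
  have : Primrec₂ fun (s : ℕ) (l : List (List ℕ)) =>
      l.flatMap fun τ => (List.range (N s)).map fun a => τ ++ [a] := by
    refine Primrec.list_flatMap Primrec.snd (Primrec.list_map ?_ ?_)
    · exact Primrec.list_range.comp (hN.comp (Primrec.fst.comp Primrec.fst))
    · exact Primrec.list_concat.comp (Primrec.snd.comp Primrec.fst) Primrec.snd
  refine (Primrec.nat_rec₁ [[]] this).of_eq fun s => ?_
  induction s with
  | zero => rfl
  | succ s ih => simp only [boundedLists, ← ih]

theorem BoundedSeq.take_mem_boundedLists {N : ℕ → ℕ} (ω : BoundedSeq N) (s : ℕ) :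
    ω.take s ∈ boundedLists N s := by
  refine mem_boundedLists.2 ⟨by simp [BoundedSeq.take], fun i hi => ?_⟩
  rw [BoundedSeq.take, getD_initialSegment _ hi]
  exact (ω i).2

theorem BoundedSeq.take_eq_iff {N : ℕ → ℕ} (ω : BoundedSeq N) {s : ℕ} {τ : List ℕ}
    (hτ : τ.length = s) : ω.take s = τ ↔ ∀ i < s, (ω i : ℕ) = τ.getD i 0 := by
  constructor
  · rintro rfl i hi
    rw [BoundedSeq.take, getD_initialSegment _ hi]
  · intro h
    apply List.ext_getElem
    · simp [BoundedSeq.take, hτ]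
    · intro i h1 h2
      have := h i (hτ ▸ h2)
      simp only [BoundedSeq.take, getElem_initialSegment]
      simpa [h2] using this

theorem measurable_take {N : ℕ → ℕ} (s : ℕ) : @Measurable _ _ _ ⊤ fun ω : BoundedSeq N => ω.take s := by
  let _ : MeasurableSpace (List ℕ) := ⊤
  have : (fun ω : BoundedSeq N => ω.take s) =
      (fun v : ∀ i : Fin s, Fin (N i) => List.ofFn fun i => (v i : ℕ)) ∘ fun ω i => ω i := by
    funext ω
    apply List.ext_getElem
    · simp [BoundedSeq.take]
    · simp [BoundedSeq.take, getElem_initialSegment]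
  rw [this]
  exact (Measurable.of_discrete
    (f := fun v : ∀ i : Fin s, Fin (N i) => List.ofFn fun i => (v i : ℕ))).comp
    (measurable_pi_lambda (fun (ω : BoundedSeq N) (i : Fin s) => ω i) fun i =>
      measurable_pi_apply (i : ℕ))

theorem measurableSet_take {N : ℕ → ℕ} (s : ℕ) (D : List ℕ → Prop) :
    MeasurableSet {ω : BoundedSeq N | D (ω.take s)} :=
  @measurable_take N s {τ | D τ} trivial

variable (N : ℕ → ℕ) [∀ i, NeZero (N i)]

/-- The product of the uniform measures on the coordinates. -/
noncomputable def uniformMeasure : Measure (BoundedSeq N) :=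
  Measure.infinitePi fun i => (PMF.uniformOfFintype (Fin (N i))).toMeasure

instance : IsProbabilityMeasure (uniformMeasure N) := by
  unfold uniformMeasure
  infer_instance

variable {N}

theorem measureReal_take_eq {s : ℕ} {τ : List ℕ} (hτ : τ ∈ boundedLists N s) :
    (uniformMeasure N).real {ω | ω.take s = τ} = ∏ i ∈ Finset.range s, (N i : ℝ)⁻¹ := by
  obtain ⟨hl, hτ⟩ := mem_boundedLists.1 hτ
  have hset : {ω : BoundedSeq N | ω.take s = τ} =
      Set.pi (Finset.range s : Set ℕ) fun i => {a : Fin (N i) | (a : ℕ) = τ.getD i 0} := by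
    ext ω
    simp [BoundedSeq.take_eq_iff ω hl]
  rw [hset, Measure.real, uniformMeasure, Measure.infinitePi_pi _ fun _ _ => .of_discrete,
    ENNReal.toReal_prod]
  refine Finset.prod_congr rfl fun i hi => ?_
  have : {a : Fin (N i) | (a : ℕ) = τ.getD i 0} = {⟨τ.getD i 0, hτ i (Finset.mem_range.1 hi)⟩} := by
    ext a
    simp [Fin.ext_iff]
  rw [this, PMF.toMeasure_apply_singleton _ _ (.singleton _)]
  simp

/-- Each initial segment of length `s` has the same measure, so the measure of an event on finitely
many coordinates is a count of lists. This makes such measures computable. -/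
theorem measureReal_take (s : ℕ) (D : List ℕ → Prop) [DecidablePred D] :
    (uniformMeasure N).real {ω | D (ω.take s)} =
      ((boundedLists N s).filter fun τ => D τ).length * ∏ i ∈ Finset.range s, (N i : ℝ)⁻¹ := by
  have hset : {ω : BoundedSeq N | D (ω.take s)} =
      ⋃ τ ∈ ((boundedLists N s).filter fun τ => D τ).toFinset, {ω | ω.take s = τ} := by
    ext ω
    simp [BoundedSeq.take_mem_boundedLists]
  rw [hset, measureReal_biUnion_finset]
  · rw [Finset.sum_congr rfl fun τ hτ => measureReal_take_eq (N := N) (s := s) ?_,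
      Finset.sum_const, List.toFinset_card_of_nodup ((nodup_boundedLists N s).filter _),
      nsmul_eq_mul]
    simp only [List.mem_toFinset, List.mem_filter] at hτ
    exact hτ.1
  · intro σ _ τ _ h
    exact Set.disjoint_left.2 fun ω h1 h2 => h (h1.symm.trans h2)
  · exact fun τ _ => measurableSet_take s (· = τ)

theorem cond_real_apply {Ω : Type*} [MeasurableSpace Ω] (μ : Measure Ω) {C : Set Ω}
    (hC : MeasurableSet C) (B : Set Ω) :
    (ProbabilityTheory.cond μ C).real B = μ.real (C ∩ B) / μ.real C := by
  simp [Measure.real, ProbabilityTheory.cond_apply hC, ENNReal.toReal_mul, ENNReal.toReal_inv,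
    inv_mul_eq_div]

/-- Some event that depends on finitely many coordinates is mostly contained in a given event of
positive measure. -/
theorem exists_half_lt_cond {B : Set (BoundedSeq N)} (hB : MeasurableSet B)
    (h0 : uniformMeasure N B ≠ 0) :
    ∃ (m : ℕ) (S : List (List ℕ)), 0 < (uniformMeasure N).real {ω | ω.take m ∈ S} ∧
      1 / 2 < (ProbabilityTheory.cond (uniformMeasure N) {ω | ω.take m ∈ S}).real B := by
  classical
  set μ := uniformMeasure N with hμ
  have hdense := Measure.MeasureDense.of_generateFrom_isSetAlgebra_finite (μ := μ)
    (isSetAlgebra_measurableCylinders (α := fun i => Fin (N i)))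
    generateFrom_measurableCylinders.symm
  have hpos : 0 < μ.real B := ENNReal.toReal_pos h0 (measure_ne_top _ _)
  -- An error below half the measure of `B` leaves more of `C` inside `B` than outside it.
  obtain ⟨C, hC, hlt⟩ := hdense.approx B hB (measure_ne_top _ _) (μ.real B / 2) (by positivity)
  obtain ⟨I, T, _, rfl⟩ := (mem_measurableCylinders _).1 hC
  set C : Set (BoundedSeq N) := cylinder (α := fun i => Fin (N i)) I T with hCdef
  have hCm : MeasurableSet C := MeasurableSet.of_mem_measurableCylinders hC
  -- All coordinates in `I` lie below `m`, so the first `m` entries decide membership in `C`.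
  let m := I.sup id + 1
  refine ⟨m, (boundedLists N m).filter fun τ => ∃ ω ∈ C, BoundedSeq.take ω m = τ, ?_⟩
  have hset : {ω : BoundedSeq N | ω.take m ∈ (boundedLists N m).filter fun τ =>
      ∃ ω ∈ C, BoundedSeq.take ω m = τ} = C := by
    ext ω
    simp only [Set.mem_ofPred_eq, List.mem_filter, BoundedSeq.take_mem_boundedLists, true_and,
      decide_eq_true_eq]
    constructor
    · rintro ⟨ω', h, he⟩
      rw [BoundedSeq.take_eq_iff ω' (by simp [BoundedSeq.take])] at he
      rw [hCdef, mem_cylinder] at h ⊢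
      convert h using 1
      funext i
      have hi : (i : ℕ) < m := Nat.lt_succ_of_le (Finset.le_sup (f := id) i.2)
      have := he i hi
      rw [BoundedSeq.take, getD_initialSegment _ hi] at this
      exact Fin.ext this.symm
    · exact fun h => ⟨ω, h, rfl⟩
  rw [hset]
  have hsd : μ.real (symmDiff B C) < μ.real B / 2 := by
    rw [Measure.real]
    exact (ENNReal.toReal_lt_toReal (measure_ne_top _ _) ENNReal.ofReal_ne_top).2 hlt |>.trans_eq
      (ENNReal.toReal_ofReal (by positivity))
  have h12 : μ.real (B \ C) + μ.real (C \ B) = μ.real (symmDiff B C) := by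
    rw [measureReal_symmDiff_eq hB hCm]
  have h3 : μ.real (B ∩ C) + μ.real (B \ C) = μ.real B := measureReal_inter_add_sdiff hCm
  have h4 : μ.real (C ∩ B) + μ.real (C \ B) = μ.real C := measureReal_inter_add_sdiff hB
  have h5 : μ.real (C ∩ B) = μ.real (B ∩ C) := by rw [Set.inter_comm]
  have h6 : (0 : ℝ) ≤ μ.real (C \ B) := measureReal_nonneg
  have hCpos : 0 < μ.real C := by linarith
  refine ⟨hCpos, ?_⟩
  rw [cond_real_apply μ hCm, lt_div_iff₀ hCpos]
  linarith

end DefStrength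

namespace DefStrength

open MeasureTheory

/-! ### Definability of the measure of a definable event -/

/-- At `⟨x, a, b, e⟩`: the inequality `a < b * μ {ω | P x ω} + e`. -/
def MeasureAbove {Ω : Type*} [MeasurableSpace Ω] (μ : Measure Ω) (P : ℕ → Ω → Prop) :
    ℕ → Unit → Prop := fun v _ =>
  (v.unpair.2.unpair.1 : ℝ) <
    v.unpair.2.unpair.2.unpair.1 * μ.real {ω | P v.unpair.1 ω} + v.unpair.2.unpair.2.unpair.2

/-- Continuity from below: a strict bound on the limit is already attained at some stage. -/
theorem lt_measureReal_iUnion_iff {Ω : Type*} [MeasurableSpace Ω] {μ : Measure Ω}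
    [IsFiniteMeasure μ] {E : ℕ → Set Ω} (hE : Monotone E) {a b e : ℝ} (hb : 0 ≤ b) :
    a < b * μ.real (⋃ s, E s) + e ↔ ∃ s, a < b * μ.real (E s) + e := by
  constructor
  · intro h
    have ht : Filter.Tendsto (fun s => b * μ.real (E s) + e) Filter.atTop
        (nhds (b * μ.real (⋃ s, E s) + e)) :=
      (((ENNReal.tendsto_toReal (measure_ne_top _ _)).comp
        (tendsto_measure_iUnion_atTop hE)).const_mul b).add_const e
    exact (ht.eventually (lt_mem_nhds h)).exists
  · rintro ⟨s, h⟩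
    refine h.trans_le ?_
    have := measureReal_mono (μ := μ) (Set.subset_iUnion E s)
    gcongr

/-- An event `∃ y, ¬ Q` is the increasing union of the complements of `∀ y ≤ m, Q`, so a strict
lower bound on its measure holds already for some `m`. For a complement, that bound says, for some
margin, that a strict lower bound on the measure of `∀ y ≤ m, Q` fails. Only the existential
quantifier over `m` and the margin and one negation are added, which is exactly one level. -/
theorem SigmaClass.measureAbove {Ω : Type*} [MeasurableSpace Ω] {O : Ω → ℕ → ℕ} {F : ℕ → ℕ}
    (hO : ∀ i, Measurable fun ω => O ω i) (μ : Measure Ω) [IsProbabilityMeasure μ]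
    (h0 : ∀ P, SigmaClass O 0 P → SigmaClass (fun _ => F) 0 (MeasureAbove μ P))
    {n : ℕ} {P : ℕ → Ω → Prop} (hP : SigmaClass O n P) :
    SigmaClass (fun _ => F) n (MeasureAbove μ P) := by
  induction n generalizing P with
  | zero => exact h0 P hP
  | succ n ih =>
    obtain ⟨Q, hQ, hQP⟩ := hP
    have h1 : Primrec fun z : ℕ => z.unpair.1 := Primrec.fst.comp Primrec.unpair
    have h2 : Primrec fun z : ℕ => z.unpair.2 := Primrec.snd.comp Primrec.unpair
    let x : ℕ → ℕ := fun z => z.unpair.1.unpair.1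
    let a : ℕ → ℕ := fun z => z.unpair.1.unpair.2.unpair.1
    let b : ℕ → ℕ := fun z => z.unpair.1.unpair.2.unpair.2.unpair.1
    let e : ℕ → ℕ := fun z => z.unpair.1.unpair.2.unpair.2.unpair.2
    let m : ℕ → ℕ := fun z => z.unpair.2.unpair.1
    let j : ℕ → ℕ := fun z => z.unpair.2.unpair.2 + 1
    have hx : Primrec x := h1.comp h1
    have ha : Primrec a := h1.comp (h2.comp h1)
    have hb : Primrec b := h1.comp (h2.comp (h2.comp h1))
    have he : Primrec e := h2.comp (h2.comp (h2.comp h1))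
    have hm : Primrec m := h1.comp h2
    have hj : Primrec j := Primrec.succ.comp (h2.comp h2)
    refine ⟨_, (ih hQ.forall_le).comp (h := fun z => Nat.pair (Nat.pair (x z) (m z))
      (Nat.pair (j z * (b z + e z)) (Nat.pair (j z * b z) (j z * a z + 1)))) ?_, fun v _ => ?_⟩
    · exact Primrec₂.natPair.comp (Primrec₂.natPair.comp hx hm) (Primrec₂.natPair.comp
        (Primrec.nat_mul.comp hj (Primrec.nat_add.comp hb he)) (Primrec₂.natPair.comp
          (Primrec.nat_mul.comp hj hb) (Primrec.succ.comp (Primrec.nat_mul.comp hj ha))))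
    · simp only [MeasureAbove, x, a, b, e, m, j, Nat.unpair_pair, hQP]
      generalize v.unpair.2.unpair.1 = a
      generalize v.unpair.2.unpair.2.unpair.1 = b
      generalize v.unpair.2.unpair.2.unpair.2 = e
      generalize v.unpair.1 = x
      have hset : {ω | ∃ y, ¬ Q (Nat.pair x y) ω} = ⋃ m, {ω | ∀ y ≤ m, Q (Nat.pair x y) ω}ᶜ := by
        ext ω
        simp only [Set.mem_ofPred_eq, Set.mem_iUnion, Set.mem_compl_iff, not_forall]
        exact ⟨fun ⟨y, h⟩ => ⟨y, y, le_rfl, h⟩, fun ⟨m, y, _, h⟩ => ⟨y, h⟩⟩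
      have hmono : Monotone fun m => {ω | ∀ y ≤ m, Q (Nat.pair x y) ω}ᶜ := fun m m' h =>
        Set.compl_subset_compl.2 fun ω hω y hy => hω y (hy.trans h)
      have hmeas : ∀ m, MeasurableSet {ω | ∀ y ≤ m, Q (Nat.pair x y) ω} := fun m => by
        simpa using hQ.forall_le.measurableSet hO (Nat.pair x m)
      rw [hset, lt_measureReal_iUnion_iff hmono (Nat.cast_nonneg b)]
      simp only [probReal_compl_eq_one_sub (hmeas _)]
      -- A positive gap is at least `1 / (j + 1)` for some `j`. Clearing denominators gives the
      -- negation of an inequality of the same shape with natural coefficients; the additive term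
      -- `e` is there so that the shape survives complementation.
      have key : ∀ r : ℝ, (a : ℝ) < b * (1 - r) + e ↔ ∃ j : ℕ, ¬ (((j + 1) * (b + e) : ℕ) : ℝ) <
          ((j + 1) * b : ℕ) * r + ((j + 1) * a + 1 : ℕ) := by
        intro r
        push_cast
        simp only [not_lt]
        constructor
        · intro h
          obtain ⟨j, hj⟩ := exists_nat_gt (1 / (b * (1 - r) + e - a))
          refine ⟨j, ?_⟩
          rw [div_lt_iff₀ (by linarith)] at hj
          nlinarith
        · rintro ⟨j, h⟩
          have hj : (0 : ℝ) < j + 1 := by positivity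
          by_contra! h'
          have := mul_le_mul_of_nonneg_left h' hj.le
          nlinarith
      simp only [key]
      constructor
      · rintro ⟨m, j, h⟩
        exact ⟨Nat.pair m j, by simpa using h⟩
      · rintro ⟨y, h⟩
        exact ⟨_, _, h⟩

/-! ### The base case: measures of open events -/

/-- The list of the pairs of corresponding entries, as long as the first list. -/
def pairEntries (L τ : List ℕ) : List ℕ :=
  (List.range L.length).map fun i => Nat.pair (L.getD i 0) (τ.getD i 0)

theorem primrec_pairEntries : Primrec₂ pairEntries := by
  refine Primrec.list_map (Primrec.list_range.comp (Primrec.list_length.comp Primrec.fst)) ?_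
  exact Primrec₂.natPair.comp
    ((Primrec.list_getD 0).comp (Primrec.fst.comp Primrec.fst) Primrec.snd)
    ((Primrec.list_getD 0).comp (Primrec.snd.comp Primrec.fst) Primrec.snd)

theorem initialSegment_pair (F G : ℕ → ℕ) (s : ℕ) :
    initialSegment (fun i => Nat.pair (F i) (G i)) s =
      pairEntries (initialSegment F s) (initialSegment G s) := by
  rw [pairEntries, length_initialSegment, initialSegment]
  refine List.map_congr_left fun i hi => ?_
  rw [getD_initialSegment _ (List.mem_range.1 hi), getD_initialSegment _ (List.mem_range.1 hi)]

variable {N : ℕ → ℕ}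

/-- The oracle that combines a fixed function with a bounded sequence. -/
def randomOracle (N F : ℕ → ℕ) (ω : BoundedSeq N) (i : ℕ) : ℕ :=
  Nat.pair (F i) (ω i)

theorem measurable_randomOracle (F : ℕ → ℕ) (i : ℕ) :
    Measurable fun ω : BoundedSeq N => randomOracle N F ω i :=
  (Measurable.of_discrete (f := fun a : Fin (N i) => Nat.pair (F i) a)).comp (measurable_pi_apply i)

theorem initialSegment_randomOracle (F : ℕ → ℕ) (ω : BoundedSeq N) (s : ℕ) :
    initialSegment (randomOracle N F ω) s = pairEntries (initialSegment F s) (ω.take s) :=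
  initialSegment_pair F _ s

theorem primrec_prod_range {N : ℕ → ℕ} (hN : Primrec N) :
    Primrec fun s => ∏ i ∈ Finset.range s, N i := by
  refine (Primrec.nat_rec₁ (f := fun i p => p * N i) 1
    (Primrec.nat_mul.comp Primrec.snd (hN.comp Primrec.fst))).of_eq fun s => ?_
  induction s with
  | zero => rfl
  | succ s ih => simp only [Finset.prod_range_succ, ← ih]

theorem primrecPred_mem_list {α : Type*} [Primcodable α] (S : List α) :
    PrimrecPred fun a => a ∈ S :=
  ((PrimrecRel.exists_mem_list (R := fun b a => b = a) Primrec.eq).comp (Primrec.const S)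
    Primrec.id).of_eq (by simp)

variable [∀ i, NeZero (N i)]

/-- The part of the event verified by stage `s` depends on the first `s` coordinates, so for `s ≥ m`
its conditional measure is the fraction `c * D m / (K * D s)`, computable from the segment of `F` of
length `s`. These parts increase to the event. -/
theorem measureAbove_cond_zero (hN : Primrec N) (F : ℕ → ℕ) (m : ℕ) (S : List (List ℕ))
    (hS : 0 < (uniformMeasure N).real {ω | ω.take m ∈ S}) {P : ℕ → BoundedSeq N → Prop}
    (hP : SigmaClass (randomOracle N F) 0 P) :
    SigmaClass (fun _ => F) 0
      (MeasureAbove (ProbabilityTheory.cond (uniformMeasure N) {ω | ω.take m ∈ S}) P) := by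
  classical
  obtain ⟨R, hR, hRP⟩ := hP
  let K := ((boundedLists N m).filter fun τ => τ ∈ S).length
  let D : ℕ → ℕ := fun s => ∏ i ∈ Finset.range s, N i
  let W : List ℕ → ℕ × List ℕ → Prop := fun τ p =>
    τ.take m ∈ S ∧ ∃ t < p.2.length + 1, R p.1 ((pairEntries p.2 τ).take t)
  let c : ℕ × List ℕ → ℕ := fun p =>
    ((boundedLists N p.2.length).filter fun τ => W τ p).length
  have hW : PrimrecRel W := by
    refine PrimrecPred.and ((primrecPred_mem_list S).comp
      (Primrec.list_take.comp (Primrec.const m) Primrec.fst)) ?_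
    have h : PrimrecRel fun (t : ℕ) (q : List ℕ × ℕ × List ℕ) =>
        R q.2.1 ((pairEntries q.2.2 q.1).take t) :=
      hR.comp (Primrec.fst.comp (Primrec.snd.comp Primrec.snd)) (Primrec.list_take.comp Primrec.fst
        (primrec_pairEntries.comp (Primrec.snd.comp (Primrec.snd.comp Primrec.snd))
          (Primrec.fst.comp Primrec.snd)))
    exact (PrimrecRel.exists_lt_param h).comp
      (Primrec.succ.comp (Primrec.list_length.comp (Primrec.snd.comp Primrec.snd))) Primrec.id
  have hc : Primrec c := Primrec.list_length.comp (hW.listFilter.comp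
    ((primrec_boundedLists hN).comp (Primrec.list_length.comp Primrec.snd)) Primrec.id)
  have hD : Primrec D := primrec_prod_range hN
  -- The inequality is multiplied by `K * D s`. The condition on the length ensures that `s`
  -- coordinates decide the conditioning event.
  refine ⟨fun v L => m ≤ L.length ∧
    v.unpair.2.unpair.1 * (K * D L.length) <
      v.unpair.2.unpair.2.unpair.1 * (c (v.unpair.1, L) * D m) +
        v.unpair.2.unpair.2.unpair.2 * (K * D L.length), ?_, fun v _ => ?_⟩
  · have h1 : Primrec fun z : ℕ => z.unpair.1 := Primrec.fst.comp Primrec.unpair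
    have h2 : Primrec fun z : ℕ => z.unpair.2 := Primrec.snd.comp Primrec.unpair
    have hl : Primrec fun p : ℕ × List ℕ => p.2.length := Primrec.list_length.comp Primrec.snd
    have hKD : Primrec fun p : ℕ × List ℕ => K * D p.2.length :=
      Primrec.nat_mul.comp (Primrec.const K) (hD.comp hl)
    refine PrimrecPred.and (Primrec.nat_le.comp (Primrec.const m) hl) (Primrec.nat_lt.comp
      (Primrec.nat_mul.comp (h1.comp (h2.comp Primrec.fst)) hKD)
      (Primrec.nat_add.comp (Primrec.nat_mul.comp (h1.comp (h2.comp (h2.comp Primrec.fst)))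
        (Primrec.nat_mul.comp (hc.comp ((h1.comp Primrec.fst).pair Primrec.snd))
          (Primrec.const (D m))))
        (Primrec.nat_mul.comp (h2.comp (h2.comp (h2.comp Primrec.fst))) hKD)))
  · simp only [MeasureAbove, length_initialSegment]
    generalize v.unpair.2.unpair.1 = a
    generalize v.unpair.2.unpair.2.unpair.1 = b
    generalize v.unpair.2.unpair.2.unpair.2 = e
    generalize v.unpair.1 = x
    let E : ℕ → Set (BoundedSeq N) := fun s =>
      {ω | ∃ t ≤ s, R x (initialSegment (randomOracle N F ω) t)}
    have hE : Monotone E := fun s s' h ω ⟨t, ht, hω⟩ => ⟨t, ht.trans h, hω⟩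
    have hPE : {ω | P x ω} = ⋃ s, E s := by
      ext ω
      simp only [hRP, E, Set.mem_ofPred_eq, Set.mem_iUnion]
      exact ⟨fun ⟨s, h⟩ => ⟨s, s, le_rfl, h⟩, fun ⟨_, t, _, h⟩ => ⟨t, h⟩⟩
    have hDpos : ∀ s, (0 : ℝ) < D s := fun s =>
      Nat.cast_pos.2 (Finset.prod_pos fun i _ => Nat.pos_of_ne_zero (NeZero.ne _))
    have hDinv : ∀ s, ∏ i ∈ Finset.range s, (N i : ℝ)⁻¹ = (D s : ℝ)⁻¹ := fun s => by
      simp [D, Finset.prod_inv_distrib]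
    have hCm : MeasurableSet {ω : BoundedSeq N | ω.take m ∈ S} := measurableSet_take m (· ∈ S)
    have hK : (uniformMeasure N).real {ω | ω.take m ∈ S} = K * (D m : ℝ)⁻¹ := by
      rw [measureReal_take m (· ∈ S), hDinv]
    have hKpos : (0 : ℝ) < K := by
      rw [hK] at hS
      exact (pos_iff_pos_of_mul_pos hS).2 (inv_pos.2 (hDpos m))
    have hEs : ∀ s, m ≤ s →
        (ProbabilityTheory.cond (uniformMeasure N) {ω | ω.take m ∈ S}).real (E s) =
          c (x, initialSegment F s) * D m / (K * D s) := by
      intro s hs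
      have hset : {ω | ω.take m ∈ S} ∩ E s = {ω | W (ω.take s) (x, initialSegment F s)} := by
        ext ω
        simp only [Set.mem_inter_iff, Set.mem_ofPred_eq, E, W, length_initialSegment,
          Nat.lt_succ_iff, ← initialSegment_randomOracle]
        refine and_congr (by rw [BoundedSeq.take, BoundedSeq.take, take_initialSegment _ hs]) ?_
        exact exists_congr fun t => and_congr_right fun ht => by rw [take_initialSegment _ ht]
      rw [cond_real_apply _ hCm, hset, hK, measureReal_take s (fun τ => W τ (x, initialSegment F s)),
        hDinv]
      simp only [c, length_initialSegment]
      have := (hDpos s).ne'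
      have := (hDpos m).ne'
      field_simp
    rw [hPE, lt_measureReal_iUnion_iff hE (Nat.cast_nonneg b)]
    have key : ∀ s, m ≤ s → ((a : ℝ) < b * (ProbabilityTheory.cond (uniformMeasure N)
        {ω | ω.take m ∈ S}).real (E s) + e ↔ a * (K * D s) <
          b * (c (x, initialSegment F s) * D m) + e * (K * D s)) := by
      intro s hs
      have hpos : (0 : ℝ) < K * D s := mul_pos hKpos (hDpos s)
      rw [hEs s hs, ← mul_lt_mul_iff_left₀ hpos, add_mul, mul_assoc (b : ℝ), div_mul_cancel₀ _ hpos.ne']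
      norm_cast
    constructor
    · rintro ⟨s, h⟩
      refine ⟨max s m, le_max_right _ _, (key _ (le_max_right _ _)).1 (h.trans_le ?_)⟩
      have := measureReal_mono (μ := ProbabilityTheory.cond (uniformMeasure N)
        {ω | ω.take m ∈ S}) (hE (le_max_left s m))
      gcongr
    · rintro ⟨s, hs, h⟩
      exact ⟨s, (key s hs).2 h⟩

/-- If a set is a section of a fixed definable predicate at a non-null set of points, then it is
definable without a point. -/
theorem SigmaClass.of_measure_ne_zero (hN : Primrec N) {F : ℕ → ℕ} {n : ℕ}
    {P : ℕ → BoundedSeq N → Prop} (hP : SigmaClass (randomOracle N F) n P) {A : Set ℕ}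
    (hA : uniformMeasure N {ω | ∀ x, x ∈ A ↔ P x ω} ≠ 0) :
    SigmaClass (fun _ => F) n fun x (_ : Unit) => x ∈ A := by
  have hmeas : ∀ x, MeasurableSet {ω | P x ω} := hP.measurableSet (measurable_randomOracle F)
  have hB : MeasurableSet {ω | ∀ x, x ∈ A ↔ P x ω} := by
    simp only [Set.ofPred_forall]
    refine MeasurableSet.iInter fun x => ?_
    by_cases hx : x ∈ A
    · simpa [hx] using hmeas x
    · simpa only [hx, false_iff, Set.compl_ofPred] using (hmeas x).compl
  obtain ⟨m, S, hpos, hlt⟩ := exists_half_lt_cond hB hA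
  set μ := ProbabilityTheory.cond (uniformMeasure N) {ω | ω.take m ∈ S} with hμ
  have : IsProbabilityMeasure μ := ProbabilityTheory.cond_isProbabilityMeasure (by
    intro h0
    simp [Measure.real, h0] at hpos)
  have hT := SigmaClass.measureAbove (measurable_randomOracle F) μ
    (fun P hP => measureAbove_cond_zero hN F m S hpos hP) hP
  -- The parameters express `1 < 2 * μ + 0`, the majority vote.
  refine (hT.comp (h := fun x => Nat.pair x (Nat.pair 1 (Nat.pair 2 0))) ?_).congr fun x _ => ?_
  · exact Primrec₂.natPair.comp Primrec.id (Primrec.const _)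
  · simp only [MeasureAbove, Nat.unpair_pair]
    push_cast
    constructor
    · intro hx
      have hsub : {ω | ∀ x, x ∈ A ↔ P x ω} ⊆ {ω | P x ω} := fun ω hω => (hω x).1 hx
      have := measureReal_mono (μ := μ) hsub
      linarith
    · intro h
      by_contra hx
      have hsub : {ω | ∀ x, x ∈ A ↔ P x ω} ⊆ {ω | P x ω}ᶜ := fun ω hω hP => hx ((hω x).2 hP)
      have h1 := measureReal_mono (μ := μ) hsub
      rw [probReal_compl_eq_one_sub (hmeas x)] at h1
      linarith

end DefStrength

namespace DefStrength

open MeasureTheory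

/-! ### Random rainbows -/

/-- The number `y` exceeds all entries of `F`, and together they form a rainbow. -/
def Extends (f : ℕ × ℕ → ℕ) (y : ℕ) (F : List ℕ) : Prop :=
  (∀ a ∈ F, a < y) ∧ IsRainbow f {a | a ∈ y :: F}

/-- There are infinitely many one-point end extensions of `F` to a rainbow. -/
def Extendible (f : ℕ × ℕ → ℕ) (F : List ℕ) : Prop :=
  {y | Extends f y F}.Infinite

theorem extendible_nil (f : ℕ × ℕ → ℕ) : Extendible f [] := by
  refine Set.infinite_univ.mono fun y _ => ⟨by simp, ?_⟩
  intro p hp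
  obtain ⟨h1, h2, h3⟩ := hp
  simp at h1 h2
  omega

theorem TwoBounded.finite {f : ℕ × ℕ → ℕ} (hf : TwoBounded f) (c : ℕ) :
    {p ∈ increasingPairs Set.univ | f p = c}.Finite :=
  Set.finite_of_encard_le_coe (k := 2) (hf c)

/-- Hence, for a given `y`, each `z` can collide with at most one `x`. -/
theorem TwoBounded.not_three {f : ℕ × ℕ → ℕ} (hf : TwoBounded f) {x x' z y : ℕ} (hx : x < y)
    (hx' : x' < y) (hz : z < y) (hxx' : x ≠ x') (hxz : x ≠ z) (hx'z : x' ≠ z)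
    (h : f (x, y) = f (z, y)) (h' : f (x', y) = f (z, y)) : False := by
  have hsub : ({(x, y), (x', y), (z, y)} : Set (ℕ × ℕ)) ⊆
      {p ∈ increasingPairs Set.univ | f p = f (z, y)} := by
    rintro p (rfl | rfl | rfl) <;> simp [increasingPairs, *]
  have h3 : ({(x, y), (x', y), (z, y)} : Set (ℕ × ℕ)).encard = 3 := by
    rw [Set.encard_insert_of_notMem (by simp [hxx', hxz]), Set.encard_pair (by simp [hx'z])]
    rfl
  have := (Set.encard_le_encard hsub).trans (hf _)
  rw [h3] at this
  exact absurd this (by decide)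

/-- If `y` extends `F` to a rainbow, and so does `x < y`, but both together do not, then the failure
is due to a pair with second entry `y`. -/
theorem exists_collision {f : ℕ × ℕ → ℕ} {F : List ℕ} {x y : ℕ} (hy : Extends f y F)
    (hx : Extends f x F) (hxy : x < y) (h : ¬ Extends f y (x :: F)) :
    (∃ z ∈ F, f (x, y) = f (z, y)) ∨
      ∃ a < y, ∃ c ∈ x :: F, ∃ d ∈ x :: F, f (a, y) = f (c, d) := by
  have hlt : ∀ a ∈ x :: F, a < y := by
    intro a ha
    rcases List.mem_cons.1 ha with rfl | ha
    exacts [hxy, hy.1 a ha]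
  have hnot : ¬ IsRainbow f {a | a ∈ y :: x :: F} := fun h' => h ⟨hlt, h'⟩
  simp only [IsRainbow, Set.InjOn, not_forall] at hnot
  obtain ⟨⟨a, b⟩, ⟨ha, hb, hab⟩, ⟨c, d⟩, ⟨hc, hd, hcd⟩, heq, hne⟩ := hnot
  simp only [Set.mem_ofPred_eq] at ha hb hc hd hab hcd
  have hfst : ∀ {a b : ℕ}, a ∈ y :: x :: F → b ∈ y :: x :: F → a < b → a ∈ x :: F := by
    intro a b ha hb hab
    rcases List.mem_cons.1 ha with rfl | ha
    · rcases List.mem_cons.1 hb with rfl | hb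
      · omega
      · have := hlt b hb
        omega
    · exact ha
  have ha' := hfst ha hb hab
  have hc' := hfst hc hd hcd
  rcases List.mem_cons.1 hb with rfl | hb'
  · rcases List.mem_cons.1 hd with rfl | hd'
    · rcases List.mem_cons.1 ha' with rfl | haF
      · rcases List.mem_cons.1 hc' with rfl | hcF
        · exact absurd rfl hne
        · exact Or.inl ⟨c, hcF, heq⟩
      · rcases List.mem_cons.1 hc' with rfl | hcF
        · exact Or.inl ⟨a, haF, heq.symm⟩
        · refine absurd (hy.2 ⟨?_, ?_, hab⟩ ⟨?_, ?_, hcd⟩ heq) hne <;> simp [haF, hcF]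
    · exact Or.inr ⟨a, hab, c, hc', d, hd', heq⟩
  · rcases List.mem_cons.1 hd with rfl | hd'
    · exact Or.inr ⟨c, hcd, a, ha', b, hb', heq.symm⟩
    · exact absurd (hx.2 (show (a, b) ∈ increasingPairs {a | a ∈ x :: F} from ⟨ha', hb', hab⟩)
        (show (c, d) ∈ increasingPairs {a | a ∈ x :: F} from ⟨hc', hd', hcd⟩) heq) hne

/-- Among the one-point extensions of an extendible rainbow `F`, at most `|F|` many are not
extendible. -/
theorem card_le_of_not_extendible {f : ℕ × ℕ → ℕ} (hf : TwoBounded f) {F : List ℕ}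
    (hF : Extendible f F) (S : Finset ℕ)
    (hS : ∀ x ∈ S, Extends f x F ∧ ¬ Extendible f (x :: F)) : S.card ≤ F.length := by
  by_contra! hlt
  let T : Set ℕ := {c | c ∈ F} ∪ S
  have hT : T.Finite := F.finite_toSet.union S.finite_toSet
  have hU₁ : (⋃ x ∈ S, {y | Extends f y (x :: F)}).Finite :=
    S.finite_toSet.biUnion fun x hx => Set.not_infinite.1 (hS x hx).2
  have hU₂ : (⋃ c ∈ T, ⋃ d ∈ T, Prod.snd '' {p ∈ increasingPairs Set.univ | f p = f (c, d)}).Finite :=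
    hT.biUnion fun c _ => hT.biUnion fun d _ => (hf.finite _).image _
  have hU₃ : (⋃ x ∈ S, Set.Iic x).Finite := S.finite_toSet.biUnion fun x _ => Set.finite_Iic x
  -- Since `F` is extendible, `y` can avoid three finite sets: it extends no `x :: F` with `x` in
  -- `S`, no pair ending in `y` has the color of a pair from `T`, and `y` exceeds all of `S`. The
  -- only collisions left are those of `(x, y)` with `(z, y)` for `z` in `F`.
  obtain ⟨y, hy, hyU⟩ := (hF.sdiff ((hU₁.union hU₂).union hU₃)).nonempty
  simp only [Set.mem_union, not_or, Set.mem_iUnion, not_exists, Set.mem_Iic, not_le] at hyU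
  obtain ⟨⟨h₁, h₂⟩, h₃⟩ := hyU
  have hz : ∀ x ∈ S, ∃ z ∈ F, f (x, y) = f (z, y) := by
    intro x hx
    refine (exists_collision hy (hS x hx).1 (h₃ x hx) (h₁ x hx)).resolve_right ?_
    have hsub : ∀ c ∈ x :: F, c ∈ T := by
      intro c hc
      rcases List.mem_cons.1 hc with rfl | hc
      exacts [Or.inr hx, Or.inl hc]
    rintro ⟨a, ha, c, hc, d, hd, h⟩
    exact h₂ c (hsub c hc) d (hsub d hd) ⟨(a, y), ⟨⟨trivial, trivial, ha⟩, h⟩, rfl⟩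
  choose! z hzF hz using hz
  -- By pigeonhole two elements of `S` share the same `z`, which gives three pairs ending in `y`
  -- with one color.
  obtain ⟨x, hx, x', hx', hne, heq⟩ := Finset.exists_ne_map_eq_of_card_lt_of_maps_to
    (t := F.toFinset) ((List.toFinset_card_le F).trans_lt hlt) (f := z)
    (fun x hx => List.mem_toFinset.2 (hzF x hx))
  refine hf.not_three (h₃ x hx) (h₃ x' hx') (hy.1 _ (hzF x hx)) hne
    ((hS x hx).1.1 _ (hzF x hx)).ne' ?_ (hz x hx) ((hz x' hx').trans (by rw [heq]))
  rw [heq]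
  exact ((hS x' hx').1.1 _ (hzF x' hx')).ne'

open Classical in
/-- The rainbow below `y` that is obtained by choosing, as the `k`-th element, the number with index
`r k` among those that extend the rainbow constructed so far. -/
noncomputable def rainbowBelow (f : ℕ × ℕ → ℕ) (r : ℕ → ℕ) : ℕ → List ℕ
  | 0 => []
  | y + 1 =>
    if Extends f y (rainbowBelow f r y) ∧
        Nat.count (fun w => Extends f w (rainbowBelow f r y)) y = r (rainbowBelow f r y).length
    then y :: rainbowBelow f r y else rainbowBelow f r y

/-- The rainbow consisting of the first `k` choices. -/
noncomputable def rainbowStage (f : ℕ × ℕ → ℕ) (r : ℕ → ℕ) : ℕ → List ℕ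
  | 0 => []
  | k + 1 => Nat.nth (fun w => Extends f w (rainbowStage f r k)) (r k) :: rainbowStage f r k

/-- The set of all choices. -/
def rainbowSet (f : ℕ × ℕ → ℕ) (r : ℕ → ℕ) : Set ℕ :=
  {y | y ∈ rainbowBelow f r (y + 1)}

/-- The indices of the choices that turn an extendible rainbow into one that is not. -/
def badChoices (f : ℕ × ℕ → ℕ) (F : List ℕ) : Set ℕ :=
  {j | Extendible f F ∧ ¬ Extendible f (Nat.nth (fun w => Extends f w F) j :: F)}

/-! ### Correctness of the construction -/

section

variable {f : ℕ × ℕ → ℕ} {r : ℕ → ℕ}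

theorem rainbowBelow_succ_of_accept {y : ℕ} (h : rainbowBelow f r (y + 1) ≠ rainbowBelow f r y) :
    rainbowBelow f r (y + 1) = y :: rainbowBelow f r y ∧ Extends f y (rainbowBelow f r y) ∧
      Nat.nth (fun w => Extends f w (rainbowBelow f r y)) (r (rainbowBelow f r y).length) = y := by
  classical
  rw [rainbowBelow] at h ⊢
  split_ifs at h ⊢ with hy
  · exact ⟨rfl, hy.1, by
      rw [← hy.2]
      exact Nat.nth_count (p := fun w => Extends f w (rainbowBelow f r y)) hy.1⟩
  · exact absurd rfl h

theorem lt_of_mem_rainbowBelow {y a : ℕ} (h : a ∈ rainbowBelow f r y) : a < y := by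
  induction y with
  | zero => simp [rainbowBelow] at h
  | succ y ih =>
    by_cases hy : rainbowBelow f r (y + 1) = rainbowBelow f r y
    · rw [hy] at h
      exact (ih h).trans (Nat.lt_succ_self y)
    · rw [(rainbowBelow_succ_of_accept hy).1] at h
      rcases List.mem_cons.1 h with rfl | h
      exacts [Nat.lt_succ_self _, (ih h).trans (Nat.lt_succ_self y)]

theorem length_rainbowBelow_le (y : ℕ) : (rainbowBelow f r y).length ≤ y := by
  induction y with
  | zero => simp [rainbowBelow]
  | succ y ih =>
    rw [rainbowBelow]
    split_ifs
    · simpa using ih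
    · omega

theorem isRainbow_rainbowBelow (y : ℕ) : IsRainbow f {a | a ∈ rainbowBelow f r y} := by
  induction y with
  | zero => simp [rainbowBelow, IsRainbow, increasingPairs]
  | succ y ih =>
    by_cases hy : rainbowBelow f r (y + 1) = rainbowBelow f r y
    · rwa [hy]
    · obtain ⟨h1, h2, _⟩ := rainbowBelow_succ_of_accept hy
      rw [h1]
      exact h2.2

/-- Links the form computed by bounded search to the form used for the probabilities. Extendibility
is not needed, since only accepted choices are counted by the length. -/
theorem rainbowBelow_eq_rainbowStage (y : ℕ) :
    rainbowBelow f r y = rainbowStage f r (rainbowBelow f r y).length := by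
  induction y with
  | zero => rfl
  | succ y ih =>
    by_cases hy : rainbowBelow f r (y + 1) = rainbowBelow f r y
    · rw [hy, ← ih]
    · obtain ⟨h1, _, h2⟩ := rainbowBelow_succ_of_accept hy
      rw [h1, List.length_cons, rainbowStage, ← ih, h2]

theorem rainbowBelow_subset {y z : ℕ} (h : y ≤ z) : rainbowBelow f r y ⊆ rainbowBelow f r z := by
  induction z, h using Nat.le_induction with
  | base => exact List.Subset.refl _
  | succ z _ ih =>
    intro a ha
    rw [rainbowBelow]
    split_ifs
    · exact List.mem_cons_of_mem _ (ih ha)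
    · exact ih ha

/-- The decision about `y` is made at step `y` and never revised, which makes the set computable
from the choices and the coloring. -/
theorem mem_rainbowSet_iff {y z : ℕ} (h : y < z) :
    y ∈ rainbowSet f r ↔ y ∈ rainbowBelow f r z := by
  refine ⟨fun hy => rainbowBelow_subset h hy, fun hy => ?_⟩
  induction z, h using Nat.le_induction with
  | base => exact hy
  | succ z hz ih =>
    by_cases he : rainbowBelow f r (z + 1) = rainbowBelow f r z
    · exact ih (he ▸ hy)
    · rw [(rainbowBelow_succ_of_accept he).1] at hy
      rcases List.mem_cons.1 hy with rfl | hy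
      exacts [absurd hz (by simp), ih hy]

theorem isRainbow_rainbowSet : IsRainbow f (rainbowSet f r) := by
  rintro ⟨a, b⟩ ⟨ha, hb, hab⟩ ⟨c, d⟩ ⟨hc, hd, hcd⟩ h
  simp only at ha hb hc hd hab hcd
  have hm : ∀ {x}, x ∈ rainbowSet f r → x ≤ max b d →
      x ∈ rainbowBelow f r (max b d + 1) := fun hx hle =>
    (mem_rainbowSet_iff (Nat.lt_succ_of_le hle)).1 hx
  exact isRainbow_rainbowBelow (r := r) (max b d + 1)
    ⟨hm ha (by omega), hm hb (by omega), hab⟩ ⟨hm hc (by omega), hm hd (by omega), hcd⟩ h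

open Classical in
/-- The index that is chosen next has not been passed yet. -/
theorem count_rainbowBelow_le (y : ℕ) :
    Nat.count (fun w => Extends f w (rainbowBelow f r y)) y ≤ r (rainbowBelow f r y).length := by
  induction y with
  | zero => simp
  | succ y ih =>
    rw [rainbowBelow]
    split_ifs with h
    -- After `y` is accepted, every further extension exceeds `y`, so the count restarts at 0.
    · refine (Nat.le_zero.2 ?_).trans (Nat.zero_le _)
      rw [Nat.count_iff_forall_not]
      intro w hw h'
      have := h'.1 y (by simp)
      omega
    · rw [Nat.count_succ]
      split_ifs with h'
      · have : Nat.count (fun w => Extends f w (rainbowBelow f r y)) y ≠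
          r (rainbowBelow f r y).length := fun h'' => h ⟨h', h''⟩
        omega
      · exact ih

/-- If nothing were ever accepted again, the count of extensions of the fixed list would pass the
chosen index, against `count_rainbowBelow_le`. -/
theorem exists_rainbowBelow_succ_ne {y : ℕ} (h : Extendible f (rainbowBelow f r y)) :
    ∃ z ≥ y, rainbowBelow f r z = rainbowBelow f r y ∧
      rainbowBelow f r (z + 1) ≠ rainbowBelow f r z := by
  classical
  by_contra! hcon
  have hconst : ∀ z ≥ y, rainbowBelow f r z = rainbowBelow f r y := by
    intro z hz
    induction z, hz using Nat.le_induction with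
    | base => rfl
    | succ z hz ih => rw [hcon z hz ih, ih]
  set F := rainbowBelow f r y
  let z := max y (Nat.nth (fun w => Extends f w F) (r F.length) + 1)
  have h1 := count_rainbowBelow_le (f := f) (r := r) z
  rw [hconst z (le_max_left _ _)] at h1
  have h2 : Nat.nth (fun w => Extends f w F) (r F.length) < z :=
    lt_of_lt_of_le (Nat.lt_succ_self _) (le_max_right _ _)
  have h3 := (Nat.count_monotone (fun w => Extends f w F) h2)
  rw [Nat.count_succ, Nat.count_nth_of_infinite h, if_pos (Nat.nth_mem_of_infinite h _)] at h3
  omega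

theorem infinite_rainbowSet (hr : ∀ k, r k ∉ badChoices f (rainbowStage f r k)) :
    (rainbowSet f r).Infinite := by
  have hall : ∀ k, ∃ y, (rainbowBelow f r y).length = k ∧ Extendible f (rainbowBelow f r y) := by
    intro k
    induction k with
    | zero => exact ⟨0, rfl, extendible_nil f⟩
    | succ k ih =>
      obtain ⟨y, rfl, hy⟩ := ih
      obtain ⟨z, _, he, hne⟩ := exists_rainbowBelow_succ_ne hy
      obtain ⟨h1, _, h3⟩ := rainbowBelow_succ_of_accept hne
      refine ⟨z + 1, by rw [h1, he, List.length_cons], ?_⟩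
      by_contra hcon
      refine hr (rainbowBelow f r z).length ?_
      rw [← rainbowBelow_eq_rainbowStage]
      exact ⟨he ▸ hy, by rwa [h3, ← h1]⟩
  refine Set.infinite_of_not_bddAbove ?_
  rintro ⟨b, hb⟩
  obtain ⟨y, hy, hyE⟩ := hall (b + 2)
  obtain ⟨z, hz, he, hne⟩ := exists_rainbowBelow_succ_ne hyE
  have hmem : z ∈ rainbowSet f r := by
    change z ∈ rainbowBelow f r (z + 1)
    rw [(rainbowBelow_succ_of_accept hne).1]
    simp
  have := hb hmem
  have := length_rainbowBelow_le (f := f) (r := r) y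
  omega

theorem length_rainbowStage (k : ℕ) : (rainbowStage f r k).length = k := by
  induction k with
  | zero => rfl
  | succ k ih => rw [rainbowStage, List.length_cons, ih]

/-- Thus the bad values for the `k`-th choice are determined by the earlier choices alone. -/
theorem rainbowStage_congr {r' : ℕ → ℕ} {k : ℕ} (h : ∀ i < k, r i = r' i) :
    rainbowStage f r k = rainbowStage f r' k := by
  induction k with
  | zero => rfl
  | succ k ih =>
    rw [rainbowStage, rainbowStage, ih fun i hi => h i (Nat.lt_succ_of_lt hi),
      h k (Nat.lt_succ_self k)]

theorem card_badChoices_le (hf : TwoBounded f) {F : List ℕ} (S : Finset ℕ)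
    (hS : ∀ j ∈ S, j ∈ badChoices f F) : S.card ≤ F.length := by
  rcases S.eq_empty_or_nonempty with rfl | ⟨j, hj⟩
  · simp
  have hF := (hS j hj).1
  rw [← Finset.card_image_of_injective S (Nat.nth_injective hF)]
  refine card_le_of_not_extendible hf hF _ fun x hx => ?_
  obtain ⟨j, hj, rfl⟩ := Finset.mem_image.1 hx
  exact ⟨Nat.nth_mem_of_infinite hF j, (hS j hj).2⟩

end

end DefStrength

/-! ### The probability of a bad choice -/

namespace DefStrength

open MeasureTheory

section

variable {N : ℕ → ℕ}

theorem length_boundedLists (s : ℕ) :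
    (boundedLists N s).length = ∏ i ∈ Finset.range s, N i := by
  induction s with
  | zero => rfl
  | succ s ih => simp [boundedLists, List.length_flatMap, Finset.prod_range_succ, ih]

variable [∀ i, NeZero (N i)]

/-- If every list of length `k` is followed by at most `c` bad values, then the probability of a bad
value at place `k` is at most `c / N k`. -/
theorem measureReal_bad_le {k c : ℕ} (B : List ℕ → Set ℕ)
    (hB : ∀ σ, σ.length = k → ∀ S : Finset ℕ, (∀ j ∈ S, j ∈ B σ) → S.card ≤ c) :
    (uniformMeasure N).real {ω | (ω k : ℕ) ∈ B (ω.take k)} ≤ c / N k := by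
  classical
  have hset : {ω : BoundedSeq N | (ω k : ℕ) ∈ B (ω.take k)} =
      {ω | (ω.take (k + 1)).getD k 0 ∈ B ((ω.take (k + 1)).take k)} := by
    ext ω
    simp only [Set.mem_ofPred_eq, BoundedSeq.take, getD_initialSegment _ (Nat.lt_succ_self k),
      take_initialSegment _ (Nat.le_succ k)]
  -- Lists of length `k + 1` are grouped by their first `k` entries; each group contains at most `c`
  -- bad ones.
  have hcount : ((boundedLists N (k + 1)).filter fun τ =>
      τ.getD k 0 ∈ B (τ.take k)).length ≤ (∏ i ∈ Finset.range k, N i) * c := by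
    rw [boundedLists, List.filter_flatMap, List.length_flatMap, ← length_boundedLists]
    refine (List.sum_le_card_nsmul _ c ?_).trans (by simp)
    intro l hl
    obtain ⟨σ, hσ, rfl⟩ := List.mem_map.1 hl
    obtain ⟨hlen, _⟩ := mem_boundedLists.1 hσ
    have hf : ((List.range (N k)).map fun a => σ ++ [a]).filter
        (fun τ => decide (τ.getD k 0 ∈ B (τ.take k))) =
        ((List.range (N k)).filter fun a => a ∈ B σ).map fun a => σ ++ [a] := by
      rw [List.filter_map]
      congr 1
      refine List.filter_congr fun a _ => ?_
      subst hlen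
      simp
    rw [hf, List.length_map, ← List.toFinset_card_of_nodup (List.nodup_range.filter _)]
    exact hB σ hlen _ fun j hj => by simpa using (List.mem_filter.1 (List.mem_toFinset.1 hj)).2
  have hpos : ∀ i, (0 : ℝ) < N i := fun i => Nat.cast_pos.2 (Nat.pos_of_ne_zero (NeZero.ne _))
  rw [hset, measureReal_take (k + 1) (fun τ => τ.getD k 0 ∈ B (τ.take k)), Finset.prod_range_succ,
    Finset.prod_inv_distrib]
  have hD : (0 : ℝ) < ∏ i ∈ Finset.range k, (N i : ℝ) := Finset.prod_pos fun i _ => hpos i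
  have hk := hpos k
  calc _ ≤ (((∏ i ∈ Finset.range k, N i) * c : ℕ) : ℝ) *
        ((∏ i ∈ Finset.range k, (N i : ℝ))⁻¹ * (N k : ℝ)⁻¹) := by gcongr
    _ = c / N k := by
      push_cast
      field_simp

end

instance (i : ℕ) : NeZero (4 ^ (i + 1)) :=
  ⟨by positivity⟩

/-- With positive probability, no choice is bad. -/
theorem measure_bad_lt_one {f : ℕ × ℕ → ℕ} (hf : TwoBounded f) :
    uniformMeasure (fun i => 4 ^ (i + 1))
      {ω | ∃ k, (ω k : ℕ) ∈ badChoices f (rainbowStage f (fun i => ω i) k)} < 1 := by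
  -- From `k ≤ 2 ^ k` one gets `k / 4 ^ (k + 1) ≤ (1 / 2) ^ k / 4`, and these bounds sum to 1/2.
  have hk : ∀ k : ℕ, uniformMeasure (fun i => 4 ^ (i + 1))
      {ω | (ω k : ℕ) ∈ badChoices f (rainbowStage f (fun i => ω i) k)} ≤
        ENNReal.ofReal ((1 / 2 : ℝ) ^ k * (1 / 4)) := by
    intro k
    have h := measureReal_bad_le (N := fun i => 4 ^ (i + 1)) (k := k) (c := k)
      (fun σ => badChoices f (rainbowStage f (fun i => σ.getD i 0) k))
      (fun σ _ S hS => (card_badChoices_le hf S hS).trans_eq (length_rainbowStage k))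
    have hst : ∀ ω : BoundedSeq fun i => 4 ^ (i + 1),
        rainbowStage f (fun i => (ω.take k).getD i 0) k = rainbowStage f (fun i => ω i) k :=
      fun ω => rainbowStage_congr fun i hi => getD_initialSegment _ hi
    simp only [hst] at h
    refine (ENNReal.le_ofReal_iff_toReal_le (measure_ne_top _ _) (by positivity)).2 (h.trans ?_)
    have h2 : (k : ℝ) ≤ 2 ^ k := by exact_mod_cast Nat.lt_two_pow_self.le
    have h4 : (4 : ℝ) ^ k = 2 ^ k * 2 ^ k := by rw [← mul_pow]; norm_num
    push_cast
    rw [pow_succ, h4, div_le_iff₀ (by positivity), one_div, inv_pow]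
    field_simp
    exact h2
  rw [Set.ofPred_exists]
  refine (measure_iUnion_le _).trans_lt ((ENNReal.tsum_le_tsum hk).trans_lt ?_)
  rw [← ENNReal.ofReal_tsum_of_nonneg (fun k => by positivity)
    (summable_geometric_two.mul_right _), tsum_mul_right, tsum_geometric_two]
  norm_num

/-! ### Computability of the random rainbow -/

theorem PrimrecPred.forall_mem {α β : Type*} [Primcodable α] [Primcodable β] {l : α → List β}
    (hl : Primrec l) {P : β → α → Prop} (hP : PrimrecRel P) :
    PrimrecPred fun x => ∀ a ∈ l x, P a x :=
  hP.forall_mem_list.comp hl Primrec.id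

theorem isRainbow_list_iff {f : ℕ × ℕ → ℕ} {l : List ℕ} :
    IsRainbow f {a | a ∈ l} ↔ ∀ a ∈ l, ∀ b ∈ l, ∀ c ∈ l, ∀ d ∈ l,
      ¬ (a < b ∧ c < d ∧ f (a, b) = f (c, d) ∧ ¬ (a = c ∧ b = d)) := by
  constructor
  · rintro h a ha b hb c hc d hd ⟨hab, hcd, heq, hne⟩
    exact hne (Prod.mk.injEq _ _ _ _ ▸ h (show (a, b) ∈ increasingPairs {a | a ∈ l} from
      ⟨ha, hb, hab⟩) (show (c, d) ∈ increasingPairs {a | a ∈ l} from ⟨hc, hd, hcd⟩) heq)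
  · rintro h ⟨a, b⟩ ⟨ha, hb, hab⟩ ⟨c, d⟩ ⟨hc, hd, hcd⟩ heq
    by_contra hne
    exact h a ha b hb c hc d hd ⟨hab, hcd, heq, fun h' => hne (by rw [h'.1, h'.2])⟩

section

variable {α : Type*} [Primcodable α] {f : α → ℕ × ℕ → ℕ} {r : α → ℕ → ℕ}

theorem primrecRel_extends (hf : Primrec₂ f) :
    PrimrecRel fun (w : ℕ) (p : List ℕ × α) => Extends (f p.2) w p.1 := by
  have h1 : PrimrecPred fun x : ℕ × List ℕ × α => ∀ a ∈ x.2.1, a < x.1 :=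
    PrimrecPred.forall_mem (P := fun a (x : ℕ × List ℕ × α) => a < x.1)
      (Primrec.fst.comp Primrec.snd) (Primrec.nat_lt.comp Primrec.fst (Primrec.fst.comp Primrec.snd))
  have hl : Primrec fun x : ℕ × List ℕ × α => x.1 :: x.2.1 :=
    Primrec.list_cons.comp Primrec.fst (Primrec.fst.comp Primrec.snd)
  let X := ℕ × List ℕ × α
  have h2 : PrimrecPred fun x : X => ∀ a ∈ x.1 :: x.2.1, ∀ b ∈ x.1 :: x.2.1,
      ∀ c ∈ x.1 :: x.2.1, ∀ d ∈ x.1 :: x.2.1, ¬ (a < b ∧ c < d ∧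
        f x.2.2 (a, b) = f x.2.2 (c, d) ∧ ¬ (a = c ∧ b = d)) := by
    refine PrimrecPred.forall_mem (β := ℕ) (α := X) hl (P := fun a x => ∀ b ∈ x.1 :: x.2.1,
      ∀ c ∈ x.1 :: x.2.1, ∀ d ∈ x.1 :: x.2.1, ¬ (a < b ∧ c < d ∧
        f x.2.2 (a, b) = f x.2.2 (c, d) ∧ ¬ (a = c ∧ b = d))) ?_
    refine PrimrecPred.forall_mem (β := ℕ) (α := ℕ × X) (hl.comp Primrec.snd)
      (P := fun b y => ∀ c ∈ y.2.1 :: y.2.2.1, ∀ d ∈ y.2.1 :: y.2.2.1, ¬ (y.1 < b ∧ c < d ∧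
        f y.2.2.2 (y.1, b) = f y.2.2.2 (c, d) ∧ ¬ (y.1 = c ∧ b = d))) ?_
    refine PrimrecPred.forall_mem (β := ℕ) (α := ℕ × ℕ × X)
      (hl.comp (Primrec.snd.comp Primrec.snd))
      (P := fun c y => ∀ d ∈ y.2.2.1 :: y.2.2.2.1, ¬ (y.2.1 < y.1 ∧ c < d ∧
        f y.2.2.2.2 (y.2.1, y.1) = f y.2.2.2.2 (c, d) ∧ ¬ (y.2.1 = c ∧ y.1 = d))) ?_
    refine PrimrecPred.forall_mem (β := ℕ) (α := ℕ × ℕ × ℕ × X)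
      (hl.comp (Primrec.snd.comp (Primrec.snd.comp Primrec.snd)))
      (P := fun d y => ¬ (y.2.2.1 < y.2.1 ∧ y.1 < d ∧
        f y.2.2.2.2.2 (y.2.2.1, y.2.1) = f y.2.2.2.2.2 (y.1, d) ∧
          ¬ (y.2.2.1 = y.1 ∧ y.2.1 = d))) ?_
    have hd : Primrec fun y : ℕ × ℕ × ℕ × ℕ × X => y.1 := Primrec.fst
    have hc : Primrec fun y : ℕ × ℕ × ℕ × ℕ × X => y.2.1 := Primrec.fst.comp Primrec.snd
    have hs : Primrec fun y : ℕ × ℕ × ℕ × ℕ × X => y.2.2 := Primrec.snd.comp Primrec.snd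
    have hb : Primrec fun y : ℕ × ℕ × ℕ × ℕ × X => y.2.2.1 := Primrec.fst.comp hs
    have ha : Primrec fun y : ℕ × ℕ × ℕ × ℕ × X => y.2.2.2.1 :=
      Primrec.fst.comp (Primrec.snd.comp hs)
    have hp : Primrec fun y : ℕ × ℕ × ℕ × ℕ × X => y.2.2.2.2.2.2 :=
      Primrec.snd.comp (Primrec.snd.comp (Primrec.snd.comp (Primrec.snd.comp hs)))
    exact PrimrecPred.not ((Primrec.nat_lt.comp ha hb).and ((Primrec.nat_lt.comp hc hd).and
      ((Primrec.eq.comp (hf.comp hp (ha.pair hb)) (hf.comp hp (hc.pair hd))).and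
        ((Primrec.eq.comp ha hc).and (Primrec.eq.comp hb hd)).not)))
  exact (h1.and h2).of_eq fun x => and_congr Iff.rfl isRainbow_list_iff.symm

/-- The coloring and the choices depend on a parameter because they will be decoded from a finite
segment of the oracle. -/
theorem primrec_rainbowBelow (hf : Primrec₂ f) (hr : Primrec₂ r) :
    Primrec₂ fun (p : α) (y : ℕ) => rainbowBelow (f p) (r p) y := by
  classical
  have hE := primrecRel_extends hf
  have hcount : Primrec fun q : α × ℕ × List ℕ =>
      Nat.count (fun w => Extends (f q.1) w q.2.2) q.2.1 := by
    refine (Primrec.list_length.comp (hE.listFilter.comp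
      (Primrec.list_range.comp (Primrec.fst.comp Primrec.snd))
      ((Primrec.snd.comp Primrec.snd).pair Primrec.fst))).of_eq fun q => ?_
    rw [Nat.count, List.countP_eq_length_filter]
  have hstep : Primrec₂ fun (p : α) (q : ℕ × List ℕ) =>
      if Extends (f p) q.1 q.2 ∧ Nat.count (fun w => Extends (f p) w q.2) q.1 = r p q.2.length
      then q.1 :: q.2 else q.2 := by
    have h1 : Primrec fun x : α × ℕ × List ℕ => x.2.1 := Primrec.fst.comp Primrec.snd
    have h2 : Primrec fun x : α × ℕ × List ℕ => x.2.2 := Primrec.snd.comp Primrec.snd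
    refine Primrec.ite (PrimrecPred.and (hE.comp h1 (h2.pair Primrec.fst)) ?_)
      (Primrec.list_cons.comp h1 h2) h2
    exact Primrec.eq.comp hcount (hr.comp Primrec.fst (Primrec.list_length.comp h2))
  refine (Primrec.nat_rec (Primrec.const []) hstep).of_eq fun p y => ?_
  induction y with
  | zero => rfl
  | succ y ih =>
    rw [rainbowBelow, ← ih]

end

theorem extends_congr {f f' : ℕ × ℕ → ℕ} {s w : ℕ} {F : List ℕ}
    (h : ∀ a b, a < b → b < s → f (a, b) = f' (a, b)) (hw : w < s) (hF : ∀ a ∈ F, a < s) :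
    Extends f w F ↔ Extends f' w F := by
  refine and_congr Iff.rfl (Set.EqOn.injOn_iff ?_)
  rintro ⟨a, b⟩ ⟨_, hb, hab⟩
  refine h a b hab ?_
  rcases List.mem_cons.1 hb with hb | hb
  exacts [lt_of_eq_of_lt hb hw, hF _ hb]

/-- The use of the construction: up to `s` it consults only the colors of pairs below `s` and the
first `s` choices. -/
theorem rainbowBelow_congr {f f' : ℕ × ℕ → ℕ} {r r' : ℕ → ℕ} {s : ℕ}
    (hf : ∀ a b, a < b → b < s → f (a, b) = f' (a, b)) (hr : ∀ k < s, r k = r' k) {y : ℕ}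
    (hy : y ≤ s) : rainbowBelow f r y = rainbowBelow f' r' y := by
  classical
  induction y with
  | zero => rfl
  | succ y ih =>
    have hF : ∀ a ∈ rainbowBelow f' r' y, a < s := fun a ha => (lt_of_mem_rainbowBelow ha).trans hy
    have hcount : Nat.count (fun w => Extends f w (rainbowBelow f' r' y)) y =
        Nat.count (fun w => Extends f' w (rainbowBelow f' r' y)) y := by
      rw [Nat.count_eq_card_filter_range, Nat.count_eq_card_filter_range]
      congr 1
      refine Finset.filter_congr fun w hw => extends_congr hf ?_ hF
      exact (Finset.mem_range.1 hw).trans hy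
    rw [rainbowBelow, rainbowBelow, ih (Nat.le_of_succ_le hy), extends_congr hf hy hF,
      hr _ ((length_rainbowBelow_le y).trans_lt hy)]
    simp only [hcount]

/-! ### Preservation of the arithmetic hierarchy -/

theorem natIndicator_of_mem {A : Set ℕ} {n : ℕ} (h : n ∈ A) : natIndicator A n = 1 := by
  simp [natIndicator, h]

theorem natIndicator_of_notMem {A : Set ℕ} {n : ℕ} (h : n ∉ A) : natIndicator A n = 0 := by
  simp [natIndicator, h]

open Classical in
theorem natIndicator_eq (A : Set ℕ) (n : ℕ) : natIndicator A n = if n ∈ A then 1 else 0 := by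
  split_ifs with h
  exacts [natIndicator_of_mem h, natIndicator_of_notMem h]

theorem natIndicator_join (Z Y : Set ℕ) (m : ℕ) :
    natIndicator (join Z Y) m =
      if m % 2 = 0 then natIndicator Z (m / 2) else natIndicator Y (m / 2) := by
  classical
  have hj : m ∈ join Z Y ↔ if m % 2 = 0 then m / 2 ∈ Z else m / 2 ∈ Y := by
    constructor
    · rintro (⟨n, hn, rfl⟩ | ⟨n, hn, rfl⟩)
      · rwa [if_pos (by omega), show 2 * n / 2 = n by omega]
      · rwa [if_neg (by omega), show (2 * n + 1) / 2 = n by omega]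
    · split_ifs with h
      · exact fun hm => Or.inl ⟨_, hm, by omega⟩
      · exact fun hm => Or.inr ⟨_, hm, by omega⟩
  simp only [natIndicator_eq, hj]
  split_ifs <;> rfl

theorem some_bind_charFun (A : Set ℕ) (n : ℕ) :
    (Part.some n >>= charFun A) = Part.some (natIndicator A n) :=
  Part.bind_some n (charFun A)

theorem setReducible_join (Z Y : Set ℕ) : SetReducible Z (join Z Y) := by
  have hd : Nat.Primrec fun n => 2 * n :=
    Primrec.nat_iff.1 (Primrec.nat_mul.comp (Primrec.const 2) Primrec.id)
  have ho : Nat.RecursiveIn {charFun (join Z Y)} (charFun (join Z Y)) := .oracle _ rfl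
  refine RecursiveIn.iff_nat.2 ((ho.comp hd.recursiveIn).of_eq fun n => ?_)
  have := natIndicator_join Z Y (2 * n)
  rw [if_pos (by omega), show 2 * n / 2 = n by omega] at this
  exact (some_bind_charFun _ _).trans (congrArg Part.some this)

theorem IsSigma.mono {X X' : Set ℕ} (h : SetReducible X X') {n : ℕ} {A : Set ℕ}
    (hA : IsSigma X n A) : IsSigma X' n A := by
  induction n generalizing A with
  | zero => exact TuringReducible.trans hA h
  | succ n ih =>
    obtain ⟨B, hB, rfl⟩ := hA
    exact ⟨B, ih hB, rfl⟩

theorem countable_isSigma (Z : Set ℕ) (n : ℕ) : {A | IsSigma Z (n + 1) A}.Countable := by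
  refine ((SigmaClass.countable (fun _ : Unit => natIndicator Z) n).image
    fun P => {x | P x ()}).mono fun A hA => ?_
  obtain ⟨P, hP, h⟩ := SigmaClass.of_isSigma (Ω := Unit) (O := fun _ => natIndicator Z)
    (X := fun _ => Z) (ω := ()) Primrec.id (fun _ s => ⟨s, rfl⟩) (fun _ t => ⟨t, rfl⟩) hA
  exact ⟨P, hP, by ext x; simp [h]⟩

/-- To preserve the arithmetic hierarchy it suffices not to make any arithmetic set simpler. -/
theorem preservesArithmeticHierarchy_of_forall {Z Y : Set ℕ}
    (h : ∀ n m A, (IsSigma Z (m + 1) A ∨ IsSigma Z (m + 1) Aᶜ) →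
      IsSigma (join Z Y) (n + 1) A → IsSigma Z (n + 1) A) :
    PreservesArithmeticHierarchy Z Y := by
  have hm : ∀ {n A}, IsSigma Z n A → IsSigma (join Z Y) n A := fun hA =>
    hA.mono (setReducible_join Z Y)
  intro n hn
  obtain ⟨n, rfl⟩ := Nat.exists_eq_succ_of_ne_zero hn.ne'
  refine ⟨fun A hA => ⟨hm hA.1, fun hA' => hA.2 ?_⟩, fun A hA => ⟨hm hA.1, fun hA' => hA.2 ?_⟩,
    fun A hA => ⟨⟨hm hA.1.1, hm hA.1.2⟩, fun hA' => hA.2.1 ?_, fun hA' => hA.2.2 ?_⟩⟩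
  · exact h n n _ (Or.inr (by simpa using hA.1)) hA'
  · exact h n n _ (Or.inr hA.1) hA'
  · exact h n (n + 1) _ (Or.inl hA.1.1) hA'
  · exact h n (n + 1) _ (Or.inl hA.1.2) hA'

/-- Almost every point preserves the arithmetic hierarchy, if its contribution to the oracle is
uniformly computable. -/
theorem ae_preservesArithmeticHierarchy {N : ℕ → ℕ} [∀ i, NeZero (N i)] (hN : Primrec N)
    {Z : Set ℕ} {F : ℕ → ℕ} (hF : Nat.RecursiveIn {charFun Z} fun n => Part.some (F n))
    {Y : BoundedSeq N → Set ℕ} {φ : List ℕ → List ℕ} (hφ : Primrec φ)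
    (h₁ : ∀ ω s, ∃ t, φ (initialSegment (randomOracle N F ω) t) =
      initialSegment (natIndicator (join Z (Y ω))) s)
    (h₂ : ∀ ω t, ∃ s, φ (initialSegment (randomOracle N F ω) t) =
      initialSegment (natIndicator (join Z (Y ω))) s) :
    ∀ᵐ ω ∂uniformMeasure N, PreservesArithmeticHierarchy Z (Y ω) := by
  have hcount : ∀ m, {A | IsSigma Z (m + 1) A ∨ IsSigma Z (m + 1) Aᶜ}.Countable := fun m =>
    ((countable_isSigma Z m).union ((countable_isSigma Z m).image compl)).mono fun A hA =>
      hA.imp id fun h => ⟨Aᶜ, h, compl_compl A⟩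
  -- Only sets `A` arithmetic in `Z` are considered, so that countably many null sets are discarded.
  -- For each `A` and `P`, either `P` defines `A` on a null set of points, or `A` is definable from
  -- `Z` at the same level.
  have hae : ∀ᵐ ω ∂uniformMeasure N, ∀ n m,
      ∀ A ∈ {A | IsSigma Z (m + 1) A ∨ IsSigma Z (m + 1) Aᶜ},
      ∀ P ∈ {P | SigmaClass (randomOracle N F) n P},
        (∀ x, x ∈ A ↔ P x ω) → IsSigma Z (n + 1) A := by
    refine ae_all_iff.2 fun n => ae_all_iff.2 fun m => (ae_ball_iff (hcount m)).2 fun A _ =>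
      (ae_ball_iff (SigmaClass.countable _ _)).2 fun P hP => ?_
    by_cases h0 : uniformMeasure N {ω | ∀ x, x ∈ A ↔ P x ω} = 0
    · have := measure_eq_zero_iff_ae_notMem.1 h0
      filter_upwards [this] with ω hω h
      exact absurd h hω
    · exact Filter.Eventually.of_forall fun ω _ =>
        (SigmaClass.of_measure_ne_zero hN hP h0).isSigma hF
  filter_upwards [hae] with ω hω
  refine preservesArithmeticHierarchy_of_forall fun n m A hA hA' => ?_
  obtain ⟨P, hP, h⟩ := SigmaClass.of_isSigma hφ h₁ h₂ hA'
  exact hω n m A hA P hP h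

/-! ### Rainbows for a given coloring -/

/-- The values of the coloring, in a form that is read off from an oracle. -/
def coloringValue (f : ℕ × ℕ → ℕ) (i : ℕ) : ℕ :=
  f (i.unpair.1, i.unpair.1 + i.unpair.2 + 1)

theorem exists_rainbow_preserving {Z : Set ℕ} {f : ℕ × ℕ → ℕ} (hf : TwoBounded f)
    (hfZ : Nat.RecursiveIn {charFun Z} fun i => Part.some (coloringValue f i)) :
    ∃ Y : Set ℕ, PreservesArithmeticHierarchy Z Y ∧ Y.Infinite ∧ IsRainbow f Y := by
  let N : ℕ → ℕ := fun i => 4 ^ (i + 1)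
  let F : ℕ → ℕ := fun i => Nat.pair (natIndicator Z i) (coloringValue f i)
  have hN : Primrec N := by
    refine (Primrec.nat_rec₁ (f := fun _ p => p * 4) 4
      (Primrec.nat_mul.comp Primrec.snd (Primrec.const 4))).of_eq fun i => ?_
    induction i with
    | zero => rfl
    | succ i ih => simp only [N] at ih ⊢; rw [pow_succ, ← ih]
  have hF : Nat.RecursiveIn {charFun Z} fun n => Part.some (F n) := by
    have ho : Nat.RecursiveIn {charFun Z} (charFun Z) := .oracle _ rfl
    refine (ho.pair hfZ).of_eq fun n => ?_
    simp [charFun, F, Seq.seq, natIndicator]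
  let Y : BoundedSeq N → Set ℕ := fun ω => rainbowSet f fun i => ω i
  -- The color of `(a, b)` with `a < b` sits at index `⟨a, b - a - 1⟩`, inverse to the indexing in
  -- `coloringValue`.
  let fL : List ℕ → ℕ × ℕ → ℕ := fun L p =>
    (L.getD (Nat.pair p.1 (p.2 - p.1 - 1)) 0).unpair.1.unpair.2
  let rL : List ℕ → ℕ → ℕ := fun L k => (L.getD k 0).unpair.2
  -- For `a < b < s` that index is below `s * s`, so a segment of length `t` contains all colors of
  -- pairs below the square root of `t`.
  let yL : List ℕ → List ℕ := fun L => rainbowBelow (fL L) (rL L) L.length.sqrt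
  let φ : List ℕ → List ℕ := fun L => (List.range L.length.sqrt).map fun m =>
    if m % 2 = 0 then (L.getD (m / 2) 0).unpair.1.unpair.1 else if m / 2 ∈ yL L then 1 else 0
  have h1 : Primrec fun z : ℕ => z.unpair.1 := Primrec.fst.comp Primrec.unpair
  have h2 : Primrec fun z : ℕ => z.unpair.2 := Primrec.snd.comp Primrec.unpair
  have hsqrt : Primrec fun L : List ℕ => L.length.sqrt :=
    Primrec.nat_sqrt.comp Primrec.list_length
  have hyL : Primrec yL := by
    refine (primrec_rainbowBelow (f := fL) (r := rL) ?_ ?_).comp Primrec.id hsqrt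
    · have ha : Primrec fun q : List ℕ × ℕ × ℕ => q.2.1 := Primrec.fst.comp Primrec.snd
      have hb : Primrec fun q : List ℕ × ℕ × ℕ => q.2.2 := Primrec.snd.comp Primrec.snd
      exact h2.comp (h1.comp ((Primrec.list_getD 0).comp Primrec.fst (Primrec₂.natPair.comp ha
        (Primrec.nat_sub.comp (Primrec.nat_sub.comp hb ha) (Primrec.const 1)))))
    · exact h2.comp ((Primrec.list_getD 0).comp Primrec.fst Primrec.snd)
  have hφ : Primrec φ := by
    refine Primrec.list_map (Primrec.list_range.comp hsqrt) ?_
    have hhalf : Primrec fun q : List ℕ × ℕ => q.2 / 2 :=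
      Primrec.nat_div.comp Primrec.snd (Primrec.const 2)
    refine Primrec.ite (Primrec.eq.comp (Primrec.nat_mod.comp Primrec.snd (Primrec.const 2))
      (Primrec.const 0)) (h1.comp (h1.comp ((Primrec.list_getD 0).comp Primrec.fst hhalf)))
      (Primrec.ite ?_ (Primrec.const 1) (Primrec.const 0))
    exact ((PrimrecRel.exists_mem_list (R := fun b a : ℕ => b = a) Primrec.eq).comp
      (hyL.comp Primrec.fst) hhalf).of_eq (by simp)
  classical
  have hφ' : ∀ ω t, φ (initialSegment (randomOracle N F ω) t) =
      initialSegment (natIndicator (join Z (Y ω))) t.sqrt := by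
    intro ω t
    set L := initialSegment (randomOracle N F ω) t with hL
    have hlen : L.length = t := by simp [hL]
    have hst : t.sqrt * t.sqrt ≤ t := Nat.sqrt_le t
    have hget : ∀ i < t, L.getD i 0 = Nat.pair (F i) (ω i) := fun i hi =>
      getD_initialSegment _ hi
    have hself : ∀ k < t.sqrt, k < t := fun k hk => by nlinarith
    have hy : yL L = rainbowBelow f (fun i => (ω i : ℕ)) t.sqrt := by
      simp only [yL, hlen]
      refine rainbowBelow_congr (s := t.sqrt) ?_ ?_ le_rfl
      · intro a b hab hb
        have hi : Nat.pair a (b - a - 1) < t := by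
          refine (Nat.pair_lt_max_add_one_sq _ _).trans_le (le_trans ?_ hst)
          rw [← sq]
          exact Nat.pow_le_pow_left (by omega) 2
        simp only [fL, hget _ hi, F, Nat.unpair_pair, coloringValue]
        congr 2
        omega
      · intro k hk
        simp only [rL, hget _ (hself k hk), Nat.unpair_pair]
    simp only [φ, hlen, hy]
    refine List.map_congr_left fun m hm => ?_
    have hm' : m / 2 < t.sqrt := (Nat.div_le_self _ _).trans_lt (List.mem_range.1 hm)
    rw [natIndicator_join, hget _ (hself _ hm'), natIndicator_eq (Y ω)]
    simp only [F, Nat.unpair_pair]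
    congr 1
    exact if_congr (mem_rainbowSet_iff hm').symm rfl rfl
  have hae := ae_preservesArithmeticHierarchy hN hF (Y := Y) hφ
    (fun ω s => ⟨s * s, by rw [hφ', Nat.sqrt_eq]⟩) (fun ω t => ⟨_, hφ' ω t⟩)
  -- An event of probability 1 meets one of positive probability.
  obtain ⟨ω, hω, hgood⟩ : ∃ ω : BoundedSeq N, PreservesArithmeticHierarchy Z (Y ω) ∧
      ¬ ∃ k, (ω k : ℕ) ∈ badChoices f (rainbowStage f (fun i => ω i) k) := by
    by_contra! hcon
    refine (measure_bad_lt_one hf).not_ge ?_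
    rw [← measure_univ (μ := uniformMeasure N)]
    refine measure_mono_ae ?_
    filter_upwards [hae] with ω hω _
    exact hcon ω hω
  exact ⟨Y ω, hω, infinite_rainbowSet (not_exists.1 hgood), isRainbow_rainbowSet⟩

/-- The color is found by searching the graph; the search stops because every increasing pair has a
color, and at the right place because it has only one. -/
theorem recursiveIn_coloringValue {f : ℕ × ℕ → ℕ} {Z : Set ℕ}
    (h : SetReducible (coloringCode f) Z) :
    Nat.RecursiveIn {charFun Z} fun i => Part.some (coloringValue f i) := by
  have h1 : Primrec fun z : ℕ => z.unpair.1 := Primrec.fst.comp Primrec.unpair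
  have h2 : Primrec fun z : ℕ => z.unpair.2 := Primrec.snd.comp Primrec.unpair
  have hq : Nat.Primrec fun z => Nat.pair (Nat.pair z.unpair.1.unpair.1
      (z.unpair.1.unpair.1 + z.unpair.1.unpair.2 + 1)) z.unpair.2 :=
    Primrec.nat_iff.1 (Primrec₂.natPair.comp (Primrec₂.natPair.comp (h1.comp h1)
      (Primrec.succ.comp (Primrec.nat_add.comp (h1.comp h1) (h2.comp h1)))) h2)
  have hs : Nat.Primrec fun z => 1 - z :=
    Primrec.nat_iff.1 (Primrec.nat_sub.comp (Primrec.const 1) Primrec.id)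
  have hX : Nat.RecursiveIn {charFun Z} (charFun (coloringCode f)) := RecursiveIn.iff_nat.1 h
  have hmem : ∀ i c, Nat.pair (Nat.pair i.unpair.1 (i.unpair.1 + i.unpair.2 + 1)) c ∈
      coloringCode f ↔ c = coloringValue f i := by
    intro i c
    constructor
    · rintro ⟨⟨a, b⟩, _, h⟩
      obtain ⟨hab, rfl⟩ := Nat.pair_eq_pair.1 h
      obtain ⟨rfl, rfl⟩ := Nat.pair_eq_pair.1 hab
      rfl
    · rintro rfl
      refine ⟨(i.unpair.1, i.unpair.1 + i.unpair.2 + 1), ⟨trivial, trivial, ?_⟩, rfl⟩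
      simp only
      omega
  refine (Nat.RecursiveIn.rfind (hs.recursiveIn.comp (hX.comp hq.recursiveIn))).of_eq fun i => ?_
  refine Part.eq_some_iff.2 (Nat.mem_rfind.2 ⟨?_, fun {c} hc => ?_⟩)
  · have := (hmem i _).2 rfl
    simp [some_bind_charFun, natIndicator_of_mem this]
  · have : Nat.pair (Nat.pair i.unpair.1 (i.unpair.1 + i.unpair.2 + 1)) c ∉ coloringCode f :=
      fun h => hc.ne ((hmem i c).1 h)
    simp [some_bind_charFun, natIndicator_of_notMem this]

/-- The code determines a coloring only on increasing pairs, while `RRT22` speaks of every function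
with that code. -/
theorem IsRainbow.congr {f g : ℕ × ℕ → ℕ} (h : coloringCode f = coloringCode g) {Y : Set ℕ}
    (hY : IsRainbow f Y) : IsRainbow g Y := by
  refine (Set.EqOn.injOn_iff fun p hp => ?_).1 hY
  obtain ⟨q, _, hq⟩ : Nat.pair (Nat.pair p.1 p.2) (f p) ∈ coloringCode g :=
    h ▸ ⟨p, ⟨trivial, trivial, hp.2.2⟩, rfl⟩
  obtain ⟨h1, h2⟩ := Nat.pair_eq_pair.1 hq
  obtain ⟨h3, h4⟩ := Nat.pair_eq_pair.1 h1
  rw [h2, Prod.ext h3 h4]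

theorem twoBounded_pair : TwoBounded fun p => Nat.pair p.1 p.2 := by
  intro c
  refine (Set.encard_le_one_iff.2 ?_).trans (by norm_num)
  rintro ⟨a, b⟩ ⟨a', b'⟩ ⟨_, h⟩ ⟨_, h'⟩
  obtain ⟨rfl, rfl⟩ := Nat.pair_eq_pair.1 (h.trans h'.symm)
  rfl

end DefStrength

theorem mainTheorem10 :
    DefStrength.AdmitsPreservationOfArithmeticHierarchy DefStrength.RRT22 := by
  intro Z X hXZ
  by_cases hX : ∃ f, X = DefStrength.coloringCode f ∧ DefStrength.TwoBounded f
  · obtain ⟨f, rfl, hf⟩ := hX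
    obtain ⟨Y, hY, hinf, hrb⟩ := DefStrength.exists_rainbow_preserving hf
      (DefStrength.recursiveIn_coloringValue hXZ)
    exact ⟨Y, hY, fun g hg _ => ⟨hinf, hrb.congr hg⟩⟩
  -- If `X` codes no 2-bounded coloring, the matrix holds vacuously, and a preserving set is
  -- supplied by any computable 2-bounded coloring, here the injective pairing.
  · have hp : Nat.Primrec (DefStrength.coloringValue fun p => Nat.pair p.1 p.2) := by
      have h1 : Primrec fun z : ℕ => z.unpair.1 := Primrec.fst.comp Primrec.unpair
      have h2 : Primrec fun z : ℕ => z.unpair.2 := Primrec.snd.comp Primrec.unpair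
      exact Primrec.nat_iff.1 (Primrec₂.natPair.comp h1
        (Primrec.succ.comp (Primrec.nat_add.comp h1 h2)))
    obtain ⟨Y, hY, _⟩ := DefStrength.exists_rainbow_preserving (Z := Z)
      DefStrength.twoBounded_pair hp.recursiveIn
    exact ⟨Y, hY, fun f hf h2 => absurd ⟨f, hf, h2⟩ hX⟩
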